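/- Let $1\le t\le \min\{m,n\}$, write $M_{m,n}^t=\{A\in M_{m,n}(\mathbb C)\mid \operatorname{rk}A<t\}$, and let $F:(\mathbb C^N,0)\to M_{m,n}(\mathbb C)$ be a holomorphic map germ such that $X=F^{-1}(M_{m,n}^t)$, with the structure given by the $t$-minors of $F$, contains $0$ and is there of codimension $(m-t+1)(n-t+1)$, i.e. $(X,0)$ is a determinantal singularity of type $(m,n,t)$. Assume $\dim (X,0)\ge m$. Assume that $\operatorname{Mat}(m,n;\mathbb C\{x\})/(J_F+J_{op})$ is of finite dimension $\tau$ over $\mathbb C$, where $J_F$ is the $\mathbb C\{x\}$-submodule generated by the partial derivatives of $F$ and $J_{op}=\langle AF+FB\rangle$, with $A$, $B$ ranging over the square matrices over $\mathbb C\{x\}$ of sizes $m$ and $n$; let $G_1,\dots,G_\tau$ represent a $\mathbb C$-basis, and let $F_s=F+\sum_i s_iG_i$, $s\in(\mathbb C^\tau,0)$, so that the spaces $X_s=F_s^{-1}(M_{m,n}^t)$ (defined by the $t$-minors of $F_s$) are the fibres of the $\mathcal G$-versal family of $X$. The Tjurina transform of $X_s$ is $Y_s=X_s\times_{M_{m,n}^t}W$,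 where $W\subset M_{m,n}\times \operatorname{Grass}(n-t+1,n)$ is the closure, with its reduced structure, of the set of pairs $(A,\ker A)$ with $\operatorname{rk}A=t-1$. Then there are neighbourhoods $U_0$ of $0\in\mathbb C^N$ and $S_0$ of $0\in\mathbb C^\tau$ such that for all $U\subseteq U_0$ and $S\subseteq S_0$ the discriminant $$D=\{s\in S\mid X_s \text{ is singular at some point of } U\}$$ decomposes as $D=D_A\cup D_B$, where (A) $D_A$ is the set of $s\in S$ over which the fibre has determinantal singularities, i.e. all $(t-1)$-minors of $F_s$ vanish at some point of $U$ (for $t=1$ the $0$-minor is $1$ and $D_A$ is empty); (B) $D_B$ is the set of $s\in S$ such that $X_s$ has a singular point $x\in U$ over which there is a singular point of $Y_s$. The same holds if in (B) only points $x$ with $\operatorname{rk}F_s(x)=t-1$ are admitted. More precisely, for $s\in S_0$ and $x\in U_0$: if $\operatorname{rk}F_s(x)<t-1$, then $X_s$ is singular at $x$; if $\operatorname{rk}F_s(x)=t-1$, then there is exactly one point of $Y_s$ over $x$, and $X_s$ is singular at $x$ if and only if $Y_s$ is singular at this point. -/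

import Mathlib

open Filter Topology

noncomputable section

namespace DetSing

/-! ### Convergent power series: germs of holomorphic functions -/

section Germs

variable {V : Type*} [NormedAddCommGroup V] [NormedSpace ℂ V]

/-- The subring of germs at `p` that have a representative holomorphic at `p`. -/
def holSubring (p : V) : Subring (Germ (𝓝 p) ℂ) where
  carrier := {g | ∃ f : V → ℂ, AnalyticAt ℂ f p ∧ (f : Germ (𝓝 p) ℂ) = g}
  mul_mem' := by
    rintro _ _ ⟨f, hf, rfl⟩ ⟨g, hg, rfl⟩
    exact ⟨f * g, hf.mul hg, rfl⟩
  add_mem' := by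
    rintro _ _ ⟨f, hf, rfl⟩ ⟨g, hg, rfl⟩
    exact ⟨f + g, hf.add hg, rfl⟩
  one_mem' := ⟨fun _ => 1, analyticAt_const, rfl⟩
  zero_mem' := ⟨fun _ => 0, analyticAt_const, rfl⟩
  neg_mem' := by
    rintro _ ⟨f, hf, rfl⟩
    exact ⟨-f, hf.neg, rfl⟩

/-- The local ring `𝒪_{V,p}` of germs at `p` of holomorphic functions on `V`; for `V = ℂ^N` and
`p = 0` this is the ring `ℂ{x₁, …, x_N}` of convergent power series. -/
abbrev HolGerm (p : V) : Type _ := holSubring p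

/-- The inclusion of the constants `ℂ → 𝒪_{V,p}`. -/
def constHom (p : V) : ℂ →+* HolGerm p where
  toFun c := ⟨((fun _ => c : V → ℂ) : Germ (𝓝 p) ℂ), fun _ => c, analyticAt_const, rfl⟩
  map_one' := rfl
  map_mul' _ _ := rfl
  map_zero' := rfl
  map_add' _ _ := rfl

instance (p : V) : Algebra ℂ (HolGerm p) := (constHom p).toAlgebra

open Classical in
/-- The germ at `p` of a function `f` that is holomorphic at `p` (and `0` for any other `f`). -/
def germAt (f : V → ℂ) (p : V) : HolGerm p :=
  if h : AnalyticAt ℂ f p then ⟨(f : Germ (𝓝 p) ℂ), f, h, rfl⟩ else 0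

end Germs

/-! ### Determinantal singularities -/

/-- The space `M_{m,n} ≅ ℂ^{mn}` of complex `m × n` matrices. -/
abbrev Mat (m n : ℕ) : Type := Fin m → Fin n → ℂ

/-- `ℂ^N` -/
abbrev Cn (N : ℕ) : Type := Fin N → ℂ

/-- The generic determinantal variety `M_{m,n}^t = {A | rk A < t}`. -/
def genericDet (m n t : ℕ) : Set (Mat m n) := {A | (Matrix.of A).rank < t}

section Spaces

variable {N m n : ℕ}

/-- The ideal of `𝒪_{ℂ^N,p}` generated by the `t`-minors of `F`; it defines the complex space
`F⁻¹(M_{m,n}^t)` near `p`. -/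
def minorIdeal (t : ℕ) (F : Cn N → Mat m n) (p : Cn N) : Ideal (HolGerm p) :=
  Ideal.span {g | ∃ (r : Fin t ↪o Fin m) (c : Fin t ↪o Fin n),
    g = germAt (fun x => ((Matrix.of (F x)).submatrix r c).det) p}

/-- The local ring at `p` of `F⁻¹(M_{m,n}^t)`. -/
abbrev detLocalRing (t : ℕ) (F : Cn N → Mat m n) (p : Cn N) : Type :=
  HolGerm p ⧸ minorIdeal t F p

/-- `p` is a singular point of `F⁻¹(M_{m,n}^t)`. -/
def IsSingularAt (t : ℕ) (F : Cn N → Mat m n) (p : Cn N) : Prop :=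
  F p ∈ genericDet m n t ∧ ¬ IsRegularLocalRing (detLocalRing t F p)

/-- The germ `F : (ℂ^N,0) → M_{m,n}` defines a determinantal singularity
`(X,0) = (F⁻¹(M_{m,n}^t),0)` of type `(m,n,t)`: the codimension of `X` at `0` is
`(m-t+1)(n-t+1)`. -/
structure IsDeterminantal (t : ℕ) (F : Cn N → Mat m n) : Prop where
  one_le : 1 ≤ t
  le_rows : t ≤ m
  le_cols : t ≤ n
  analytic : AnalyticAt ℂ F 0
  mem : F 0 ∈ genericDet m n t
  codim : ringKrullDim (detLocalRing t F 0) + (((m - t + 1) * (n - t + 1) : ℕ) : WithBot ℕ∞)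
    = (N : WithBot ℕ∞)

/-! ### `𝒢`-versal families -/

/-- The matrix over `ℂ{x}` given by the germ of `F` at `0`. -/
def matGerm (F : Cn N → Mat m n) : Matrix (Fin m) (Fin n) (HolGerm (0 : Cn N)) :=
  Matrix.of fun i j => germAt (fun x => F x i j) 0

/-- `J_F`: the submodule generated by the partial derivatives `∂F/∂x_k` of `F`. -/
def JF (F : Cn N → Mat m n) :
    Submodule (HolGerm (0 : Cn N)) (Matrix (Fin m) (Fin n) (HolGerm (0 : Cn N))) :=
  Submodule.span _ (Set.range fun k : Fin N =>
    matGerm fun x => fderiv ℂ F x (Pi.single k 1))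

/-- `J_op = ⟨A F + F B⟩`, with `A`, `B` square matrices over `ℂ{x}`. -/
def Jop (F : Cn N → Mat m n) :
    Submodule (HolGerm (0 : Cn N)) (Matrix (Fin m) (Fin n) (HolGerm (0 : Cn N))) :=
  Submodule.span _ {M | ∃ (A : Matrix (Fin m) (Fin m) (HolGerm (0 : Cn N)))
    (B : Matrix (Fin n) (Fin n) (HolGerm (0 : Cn N))), M = A * matGerm F + matGerm F * B}

/-- `Mat(m,n;ℂ{x}) / (J_F + J_op)`, whose complex dimension is the `𝒢`-Tjurina number. -/
abbrev T1G (F : Cn N → Mat m n) : Type :=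
  Matrix (Fin m) (Fin n) (HolGerm (0 : Cn N)) ⧸ (JF F ⊔ Jop F)

/-- The matrices `G₁, …, G_τ` are holomorphic at `0` and represent a `ℂ`-basis of
`Mat(m,n;ℂ{x}) / (J_F + J_op)` (so this space has finite dimension `τ`). -/
structure IsGVersalBasis (F : Cn N → Mat m n) {τ : ℕ} (G : Fin τ → Cn N → Mat m n) : Prop where
  analytic : ∀ i, AnalyticAt ℂ (G i) 0
  linearIndependent : LinearIndependent ℂ
    (fun i => (Submodule.Quotient.mk (matGerm (G i)) : T1G F))
  span_eq_top : Submodule.span ℂ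
    (Set.range fun i => (Submodule.Quotient.mk (matGerm (G i)) : T1G F)) = ⊤

/-- The family of matrices `F_s = F + ∑ sᵢ Gᵢ` with base `ℂ^τ`. When the `Gᵢ` represent a basis
of `Mat(m,n;ℂ{x}) / (J_F + J_op)`, the spaces `F_s⁻¹(M_{m,n}^t)` are the fibres of the
`𝒢`-versal family of `F⁻¹(M_{m,n}^t)`. -/
def versalFamily (F : Cn N → Mat m n) {τ : ℕ} (G : Fin τ → Cn N → Mat m n) (s : Cn τ) :
    Cn N → Mat m n :=
  fun x => F x + ∑ i, s i • G i x

/-! ### The Tjurina transform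

The map `P` sends a matrix of rank exactly `t - 1` to its kernel, a point of the Grassmannian
`Grass(n-t+1, n)` of `(n-t+1)`-dimensional subspaces of `ℂⁿ`. The space `W` is the closure of the
graph of `P` in `M_{m,n} × Grass(n-t+1, n)`, with its reduced structure, and the Tjurina transform
of `X = F⁻¹(M_{m,n}^t)` is the fibre product `Y = X ×_{M_{m,n}^t} W`. -/

/-- The kernel of a matrix, as a subspace of `ℂⁿ`. -/
def matKer (A : Mat m n) : Submodule ℂ (EuclideanSpace ℂ (Fin n)) :=
  LinearMap.ker (Matrix.toLpLin 2 2 (Matrix.of A))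

/-- The coordinate space of the standard affine chart of the Grassmannian around the point `K`,
in which `0` corresponds to `K`. -/
abbrev GrChart (K : Submodule ℂ (EuclideanSpace ℂ (Fin n))) : Type := K →L[ℂ] Kᗮ

/-- The subspace with coordinate `φ` in the chart around `K`: the graph of `φ : K → Kᗮ`. -/
def chartPoint (K : Submodule ℂ (EuclideanSpace ℂ (Fin n))) (φ : GrChart K) :
    Submodule ℂ (EuclideanSpace ℂ (Fin n)) :=
  LinearMap.range (K.subtype + Kᗮ.subtype ∘ₗ (φ : K →ₗ[ℂ] Kᗮ))

/-- `W`, the closure of the graph of `P`, in the chart `M_{m,n} × GrChart K`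
of `M_{m,n} × Grass(n-t+1, n)`. -/
def tjurinaW (m : ℕ) (t : ℕ) (K : Submodule ℂ (EuclideanSpace ℂ (Fin n))) :
    Set (Mat m n × GrChart K) :=
  closure {w | (Matrix.of w.1).rank + 1 = t ∧ matKer w.1 = chartPoint K w.2}

/-- The ideal of `Y = X ×_{M_{m,n}^t} W ⊆ ℂ^N × Grass(n-t+1, n)` at the point `(p, K)`, in the
chart `ℂ^N × GrChart K`: it is generated by the equations of `X` and by the functions
`f(F(x), φ)`, where `f` is holomorphic at `(F(p), K)` and vanishes on `W`. -/
def tjurinaIdeal (t : ℕ) (F : Cn N → Mat m n) (p : Cn N)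
    (K : Submodule ℂ (EuclideanSpace ℂ (Fin n))) : Ideal (HolGerm ((p, 0) : Cn N × GrChart K)) :=
  Ideal.span
    ({g | ∃ (r : Fin t ↪o Fin m) (c : Fin t ↪o Fin n),
        g = germAt (fun y => ((Matrix.of (F y.1)).submatrix r c).det) (p, 0)} ∪
     {g | ∃ f : Mat m n × GrChart K → ℂ, AnalyticAt ℂ f (F p, 0) ∧
        (∀ᶠ w in 𝓝 (F p, 0), w ∈ tjurinaW m t K → f w = 0) ∧
        g = germAt (fun y => f (F y.1, y.2)) (p, 0)})

/-- `(p, K)` is a point of the Tjurina transform of `F⁻¹(M_{m,n}^t)`. -/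
def IsTjurinaPoint (t : ℕ) (F : Cn N → Mat m n) (p : Cn N)
    (K : Submodule ℂ (EuclideanSpace ℂ (Fin n))) : Prop :=
  Module.finrank ℂ K + t = n + 1 ∧ F p ∈ genericDet m n t ∧ (F p, 0) ∈ tjurinaW m t K

/-- `(p, K)` is a singular point of the Tjurina transform of `F⁻¹(M_{m,n}^t)`. -/
def IsTjurinaSingularAt (t : ℕ) (F : Cn N → Mat m n) (p : Cn N)
    (K : Submodule ℂ (EuclideanSpace ℂ (Fin n))) : Prop :=
  IsTjurinaPoint t F p K ∧
    ¬ IsRegularLocalRing (HolGerm ((p, 0) : Cn N × GrChart K) ⧸ tjurinaIdeal t F p K)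

/-! ### The discriminant and its two contributions

`𝓕 s` is the matrix of the fibre over `s`; the fibres are considered in `U ⊆ ℂ^N` and the base
is restricted to `S ⊆ ℂ^τ`. -/

variable {τ : ℕ}

/-- The base points over which the fibre has a singularity. -/
def discriminant (t : ℕ) (𝓕 : Cn τ → Cn N → Mat m n) (U : Set (Cn N)) (S : Set (Cn τ)) :
    Set (Cn τ) :=
  {s ∈ S | ∃ x ∈ U, IsSingularAt t (𝓕 s) x}

/-- Contribution (A): the base points over which the fibre has a determinantal singularity, that
is, a point at which all `(t-1)`-minors vanish. -/
def contributionA (t : ℕ) (𝓕 : Cn τ → Cn N → Mat m n) (U : Set (Cn N)) (S : Set (Cn τ)) :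
    Set (Cn τ) :=
  {s ∈ S | ∃ x ∈ U, ∀ (r : Fin (t - 1) ↪o Fin m) (c : Fin (t - 1) ↪o Fin n),
    ((Matrix.of (𝓕 s x)).submatrix r c).det = 0}

/-- Contribution (B): the base points over which the fibre has a singularity that gives a
singular point of its Tjurina transform. -/
def contributionB (t : ℕ) (𝓕 : Cn τ → Cn N → Mat m n) (U : Set (Cn N)) (S : Set (Cn τ)) :
    Set (Cn τ) :=
  {s ∈ S | ∃ x ∈ U, IsSingularAt t (𝓕 s) x ∧ ∃ K, IsTjurinaSingularAt t (𝓕 s) x K}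

/-- The part of contribution (B) that comes from points outside the locus of determinantal
singularities, that is, from points at which the matrix has rank exactly `t - 1`. -/
def contributionB' (t : ℕ) (𝓕 : Cn τ → Cn N → Mat m n) (U : Set (Cn N)) (S : Set (Cn τ)) :
    Set (Cn τ) :=
  {s ∈ S | ∃ x ∈ U, (Matrix.of (𝓕 s x)).rank + 1 = t ∧ IsSingularAt t (𝓕 s) x ∧
    ∃ K, IsTjurinaSingularAt t (𝓕 s) x K}

end Spaces

end DetSing

end

open Filter Topology

noncomputable section

namespace DetSing

/-! ### Hadamard's lemma for holomorphic maps. -/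

section DividedDifference

variable {V F : Type*} [NormedAddCommGroup V] [NormedSpace ℂ V] [NormedAddCommGroup F]
  [NormedSpace ℂ F]

/-! The fibres are examined point by point, according to the rank of `F_s(x)`.

If the rank is below `t - 1`, the `t`-minors vanish at `x` to second order, because the derivative
of a determinant is a combination of cofactors and these vanish in corank at least 2
(`fderiv_det_eq_zero`). So the ideal `I` of the fibre lies in the square of the maximal ideal, and
its local ring has embedding dimension `N`. If `I ≠ 0`, its dimension is smaller than `N`, so it is
not regular (`not_isRegularLocalRing_quotient`). That `I ≠ 0` holds uniformly near the origin
follows from the positive codimension of `X` and the identity theorem (`exists_nhds_versalFamily`).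

If the rank is exactly `t - 1`, the kernel is the only point of the Tjurina transform over `x`. Near
such matrices the kernel is given by a holomorphic map `P` into a chart of the Grassmannian, so `W`
is locally a graph over the matrices of rank `t - 1`. Then `x ↦ (x, P(F(x)))` and the projection
induce inverse isomorphisms of local rings (`nonempty_ringEquiv_tjurina`). Since `W` is reduced,
this requires that the `t`-minors generate every function vanishing on the matrices of rank `t - 1`;
a retraction built from Schur complements proves it (`germAt_comp_mem_minorIdeal`).

All these ideal memberships rest on Hadamard's lemma: `f ∘ a - f ∘ b` lies in the ideal generated by
the coordinates of `a - b` (`germAt_comp_sub_mem`). -/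

/-- The map `(a, b) ↦ s a + (1 - s) b`. -/
def segMap (V : Type*) [NormedAddCommGroup V] [NormedSpace ℂ V] (s : ℝ) : V × V →L[ℂ] V :=
  (s : ℂ) • ContinuousLinearMap.fst ℂ V V + ((1 - s : ℝ) : ℂ) • ContinuousLinearMap.snd ℂ V V

lemma segMap_apply (s : ℝ) (y : V × V) :
    segMap V s y = (s : ℂ) • y.1 + ((1 - s : ℝ) : ℂ) • y.2 := rfl

lemma segMap_diag (s : ℝ) (w : V) : segMap V s (w, w) = w := by
  rw [segMap_apply, ← add_smul]; simp

lemma continuous_segMap : Continuous (segMap V) := by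
  unfold segMap; fun_prop

lemma norm_segMap_apply_le {s : ℝ} (hs : s ∈ Set.Icc (0 : ℝ) 1) (y : V × V) :
    ‖segMap V s y‖ ≤ ‖y‖ := by
  have h1 : ‖(s : ℂ)‖ = s := by simp [abs_of_nonneg hs.1]
  have h2 : ‖((1 - s : ℝ) : ℂ)‖ = 1 - s := by
    rw [Complex.norm_real, Real.norm_of_nonneg (by linarith [hs.2])]
  calc ‖segMap V s y‖ ≤ s * ‖y.1‖ + (1 - s) * ‖y.2‖ := by
        rw [segMap_apply]
        refine (norm_add_le _ _).trans ?_
        rw [norm_smul, norm_smul, h1, h2]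
    _ ≤ s * ‖y‖ + (1 - s) * ‖y‖ := by
        have h3 : 0 ≤ 1 - s := by linarith [hs.2]
        exact add_le_add (mul_le_mul_of_nonneg_left (norm_fst_le y) hs.1)
          (mul_le_mul_of_nonneg_left (norm_snd_le y) h3)
    _ = ‖y‖ := by ring

lemma norm_segMap_le {s : ℝ} (hs : s ∈ Set.Icc (0 : ℝ) 1) : ‖segMap V s‖ ≤ 1 :=
  ContinuousLinearMap.opNorm_le_bound _ zero_le_one fun y => by
    simpa using norm_segMap_apply_le hs y

lemma segMap_mem_ball {s : ℝ} (hs : s ∈ Set.Icc (0 : ℝ) 1) {w : V} {r : ENNReal} {y : V × V}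
    (hy : y ∈ Metric.eball (w, w) r) : segMap V s y ∈ Metric.eball w r := by
  have h1 : segMap V s y - w = segMap V s (y - (w, w)) := by
    rw [map_sub, segMap_diag]
  rw [Metric.mem_eball, edist_eq_enorm_sub] at hy ⊢
  rw [h1]
  refine lt_of_le_of_lt ?_ hy
  rw [enorm_le_iff_norm_le]
  exact norm_segMap_apply_le hs _

lemma continuous_comp_segMap {E : Type*} [NormedAddCommGroup E] [NormedSpace ℂ E] {n : ℕ}
    (q : ContinuousMultilinearMap ℂ (fun _ : Fin n => V) E) :
    Continuous fun s : ℝ => q.compContinuousLinearMap fun _ => segMap V s := by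
  have := (ContinuousMultilinearMap.compContinuousLinearMapContinuousMultilinear ℂ
    (fun _ : Fin n => V × V) (fun _ : Fin n => V) E).cont
  have h2 : Continuous fun s : ℝ =>
      (ContinuousMultilinearMap.compContinuousLinearMapContinuousMultilinear ℂ
        (fun _ : Fin n => V × V) (fun _ : Fin n => V) E) (fun _ => segMap V s) :=
    this.comp (continuous_pi fun _ => continuous_segMap)
  exact h2.clm_apply continuous_const

/-- The power series of the average of an analytic function over a segment. -/
def segSeries {E : Type*} [NormedAddCommGroup E] [NormedSpace ℂ E]
    (q : FormalMultilinearSeries ℂ V E) : FormalMultilinearSeries ℂ (V × V) E :=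
  fun n => ∫ s in (0 : ℝ)..1, (q n).compContinuousLinearMap fun _ => segMap V s

/-- The Taylor series of `g` is integrated term by term. Each `segMap V s` is linear, of norm at
most 1, and sends `(w, w)` to `w`, so neither the coefficients nor the distance to the centre grow
and the radius is kept. -/
lemma hasFPowerSeriesOnBall_segAverage {E : Type*} [NormedAddCommGroup E] [NormedSpace ℂ E]
    [CompleteSpace E] {g : V → E} {q : FormalMultilinearSeries ℂ V E} {w : V} {r : ENNReal}
    (hg : HasFPowerSeriesOnBall g q w r) :
    HasFPowerSeriesOnBall (fun y : V × V => ∫ s in (0 : ℝ)..1, g (segMap V s y))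
      (segSeries q) (w, w) r where
  r_pos := hg.r_pos
  r_le := by
    refine hg.r_le.trans ?_
    refine FormalMultilinearSeries.radius_le_of_le fun n => ?_
    have := intervalIntegral.norm_integral_le_of_norm_le_const (a := (0 : ℝ)) (b := 1)
      (f := fun s => (q n).compContinuousLinearMap fun _ => segMap V s) (C := ‖q n‖) ?_
    · simpa [segSeries] using this
    intro s hs
    rw [Set.uIoc_of_le zero_le_one] at hs
    refine ((q n).norm_compContinuousLinearMap_le _).trans ?_
    refine mul_le_of_le_one_right (norm_nonneg _) ?_
    exact Finset.prod_le_one (fun _ _ => norm_nonneg _)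
      fun _ _ => norm_segMap_le ⟨hs.1.le, hs.2⟩
  hasSum := by
    intro y hy
    have hy' : ‖y‖ₑ < q.radius := by
      have := hg.r_le
      refine lt_of_lt_of_le ?_ this
      simpa [Metric.mem_eball, edist_zero_right] using hy
    have hsum : Summable fun n => ‖q n‖ * ‖y‖ ^ n := by
      have := q.summable_norm_mul_pow (r := ‖y‖₊) hy'
      simpa using this
    have key : ∀ n, (segSeries q n fun _ => y) =
        ∫ s in (0 : ℝ)..1, q n fun _ => segMap V s y := by
      intro n
      have h := (ContinuousMultilinearMap.apply ℂ (fun _ : Fin n => V × V) E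
        (fun _ => y)).intervalIntegral_comp_comm (a := 0) (b := 1) (μ := MeasureTheory.volume)
        ((continuous_comp_segMap (q n)).intervalIntegrable 0 1)
      exact h.symm
    simp_rw [key]
    refine intervalIntegral.hasSum_integral_of_dominated_convergence
      (fun n _ => ‖q n‖ * ‖y‖ ^ n) ?_ ?_ ?_ ?_ ?_
    · intro n
      refine Continuous.aestronglyMeasurable ?_
      exact (q n).cont.comp (continuous_pi fun _ => continuous_segMap.clm_apply continuous_const)
    · intro n
      refine Filter.Eventually.of_forall fun s hs => ?_
      rw [Set.uIoc_of_le zero_le_one] at hs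
      refine ((q n).le_opNorm _).trans ?_
      rw [Finset.prod_const, Finset.card_univ, Fintype.card_fin]
      gcongr
      exact norm_segMap_apply_le ⟨hs.1.le, hs.2⟩ y
    · exact Filter.Eventually.of_forall fun s _ => hsum
    · exact intervalIntegrable_const
    · refine Filter.Eventually.of_forall fun s hs => ?_
      rw [Set.uIoc_of_le zero_le_one] at hs
      rw [map_add, segMap_diag]
      refine hg.hasSum ?_
      have := segMap_mem_ball (w := (0 : V)) (r := r) (y := y) ⟨hs.1.le, hs.2⟩ hy
      exact this

/-- The Hadamard lemma: `f a - f b = h (a, b) (a - b)` with an analytic `h`. -/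
theorem exists_analyticAt_sub_eq [CompleteSpace F] {f : V → F} {w : V} (hf : AnalyticAt ℂ f w) :
    ∃ h : V × V → (V →L[ℂ] F), AnalyticAt ℂ h (w, w) ∧
      ∀ᶠ y in 𝓝 (w, w), f y.1 - f y.2 = h y (y.1 - y.2) := by
  obtain ⟨p, r, hp⟩ := hf
  -- The witness `h` is the average of the derivative of `f` over the segment; the identity is the
  -- fundamental theorem of calculus along it.
  have hd := hasFPowerSeriesOnBall_segAverage hp.fderiv
  refine ⟨_, hd.analyticAt, ?_⟩
  filter_upwards [Metric.eball_mem_nhds (w, w) hp.r_pos] with y hy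
  have hseg : ∀ s ∈ Set.uIcc (0 : ℝ) 1, AnalyticAt ℂ f (segMap V s y) := fun s hs => by
    rw [Set.uIcc_of_le zero_le_one] at hs
    exact hp.analyticAt_of_mem (segMap_mem_ball hs hy)
  have hcont : ContinuousOn (fun s : ℝ => fderiv ℂ f (segMap V s y)) (Set.uIcc 0 1) := by
    intro s hs
    exact ((hseg s hs).fderiv.continuousAt.comp
      (f := fun s => segMap V s y)
      (continuous_segMap.clm_apply continuous_const).continuousAt).continuousWithinAt
  have h1 : ∀ s ∈ Set.uIcc (0 : ℝ) 1,
      HasDerivAt (fun s : ℝ => f (segMap V s y)) (fderiv ℂ f (segMap V s y) (y.1 - y.2)) s := by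
    intro s hs
    have hm : HasDerivAt (fun s : ℝ => segMap V s y) (y.1 - y.2) s := by
      have e : (fun s : ℝ => segMap V s y) = fun s : ℝ => s • (y.1 - y.2) + y.2 := by
        funext s
        rw [segMap_apply, Complex.coe_smul, Complex.coe_smul]
        module
      rw [e]
      simpa using ((hasDerivAt_id s).smul_const (y.1 - y.2)).add_const y.2
    exact ((hseg s hs).differentiableAt.hasFDerivAt.restrictScalars ℝ).comp_hasDerivAt s hm
  have h2 := intervalIntegral.integral_eq_sub_of_hasDerivAt h1
    ((hcont.clm_apply continuousOn_const).intervalIntegrable)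
  have h3 := (ContinuousLinearMap.apply ℂ F (y.1 - y.2)).intervalIntegral_comp_comm
    (a := 0) (b := 1) (μ := MeasureTheory.volume) hcont.intervalIntegrable
  simp only [ContinuousLinearMap.apply_apply] at h3
  rw [← h3, h2]
  simp [segMap_apply]

end DividedDifference

/-! ### Calculus in the ring of holomorphic germs. -/

section GermCalculus

variable {V W : Type*} [NormedAddCommGroup V] [NormedSpace ℂ V] [NormedAddCommGroup W]
  [NormedSpace ℂ W] {p : V} {f g : V → ℂ}

lemma coe_germAt (hf : AnalyticAt ℂ f p) :
    (germAt f p : Germ (𝓝 p) ℂ) = (f : Germ (𝓝 p) ℂ) := by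
  rw [germAt, dif_pos hf]

lemma germAt_eq_germAt (hf : AnalyticAt ℂ f p) (hg : AnalyticAt ℂ g p) :
    germAt f p = germAt g p ↔ f =ᶠ[𝓝 p] g := by
  rw [Subtype.ext_iff, coe_germAt hf, coe_germAt hg, Germ.coe_eq]

lemma exists_germAt_eq (a : HolGerm p) : ∃ f : V → ℂ, AnalyticAt ℂ f p ∧ germAt f p = a := by
  obtain ⟨f, hf, h⟩ := a.2
  exact ⟨f, hf, Subtype.ext ((coe_germAt hf).trans h)⟩

lemma germAt_add (hf : AnalyticAt ℂ f p) (hg : AnalyticAt ℂ g p) :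
    germAt (fun x => f x + g x) p = germAt f p + germAt g p := by
  apply Subtype.ext
  rw [Subring.coe_add, coe_germAt hf, coe_germAt hg, coe_germAt (hf.fun_add hg)]
  rfl

lemma germAt_sub (hf : AnalyticAt ℂ f p) (hg : AnalyticAt ℂ g p) :
    germAt (fun x => f x - g x) p = germAt f p - germAt g p := by
  apply Subtype.ext
  rw [AddSubgroupClass.coe_sub, coe_germAt hf, coe_germAt hg, coe_germAt (hf.fun_sub hg)]
  rfl

lemma germAt_mul (hf : AnalyticAt ℂ f p) (hg : AnalyticAt ℂ g p) :
    germAt (fun x => f x * g x) p = germAt f p * germAt g p := by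
  apply Subtype.ext
  rw [Subring.coe_mul, coe_germAt hf, coe_germAt hg, coe_germAt (hf.fun_mul hg)]
  rfl

lemma germAt_zero : germAt (fun _ => 0) p = 0 := by
  apply Subtype.ext
  rw [coe_germAt analyticAt_const]
  rfl

lemma germAt_one : germAt (fun _ => 1) p = 1 := by
  apply Subtype.ext
  rw [coe_germAt analyticAt_const]
  rfl

lemma germAt_sum {ι : Type*} (s : Finset ι) {f : ι → V → ℂ} (hf : ∀ i, AnalyticAt ℂ (f i) p) :
    germAt (fun x => ∑ i ∈ s, f i x) p = ∑ i ∈ s, germAt (f i) p := by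
  classical
  induction s using Finset.induction_on with
  | empty => simpa using germAt_zero
  | insert i s hi ih =>
    simp_rw [Finset.sum_insert hi]
    rw [germAt_add (hf i) (Finset.analyticAt_fun_sum _ fun j _ => hf j), ih]

lemma germAt_pow (hf : AnalyticAt ℂ f p) (n : ℕ) :
    germAt (fun x => f x ^ n) p = germAt f p ^ n := by
  induction n with
  | zero => simpa using germAt_one
  | succ n ih => simp_rw [pow_succ]; rw [germAt_mul (hf.fun_pow n) hf, ih]

/-- Analyticity at `p` depends only on the germ, so the default value `0` is taken on both sides or
on neither. -/
lemma germAt_congr (h : f =ᶠ[𝓝 p] g) : germAt f p = germAt g p := by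
  by_cases hf : AnalyticAt ℂ f p
  · exact (germAt_eq_germAt hf (hf.congr h)).2 h
  · rw [germAt, germAt, dif_neg hf, dif_neg fun hg => hf (hg.congr h.symm)]

/-- The value of a germ at its base point. -/
def germEval (p : V) : HolGerm p →+* ℂ := Germ.valueRingHom.comp (holSubring p).subtype

lemma germEval_germAt (hf : AnalyticAt ℂ f p) : germEval p (germAt f p) = f p := by
  change Germ.value (germAt f p : Germ (𝓝 p) ℂ) = f p
  rw [coe_germAt hf]
  rfl

lemma germEval_surjective (p : V) : Function.Surjective (germEval p) := fun c =>
  ⟨germAt (fun _ => c) p, germEval_germAt analyticAt_const⟩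

/-- The differential at the base point of a germ. -/
def germDiff (p : V) (a : HolGerm p) : V →L[ℂ] ℂ := fderiv ℂ (exists_germAt_eq a).choose p

lemma germDiff_germAt (hf : AnalyticAt ℂ f p) : germDiff p (germAt f p) = fderiv ℂ f p := by
  have h := (exists_germAt_eq (germAt f p)).choose_spec
  exact ((germAt_eq_germAt h.1 hf).1 h.2).fderiv_eq

lemma germDiff_add (a b : HolGerm p) : germDiff p (a + b) = germDiff p a + germDiff p b := by
  obtain ⟨f, hf, rfl⟩ := exists_germAt_eq a
  obtain ⟨g, hg, rfl⟩ := exists_germAt_eq b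
  rw [← germAt_add hf hg, germDiff_germAt hf, germDiff_germAt hg, germDiff_germAt (hf.fun_add hg)]
  exact fderiv_add hf.differentiableAt hg.differentiableAt

lemma germDiff_mul (a b : HolGerm p) :
    germDiff p (a * b) = germEval p a • germDiff p b + germEval p b • germDiff p a := by
  obtain ⟨f, hf, rfl⟩ := exists_germAt_eq a
  obtain ⟨g, hg, rfl⟩ := exists_germAt_eq b
  rw [← germAt_mul hf hg, germDiff_germAt hf, germDiff_germAt hg, germDiff_germAt (hf.fun_mul hg),
    germEval_germAt hf, germEval_germAt hg]
  exact fderiv_mul hf.differentiableAt hg.differentiableAt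

lemma germDiff_zero : germDiff p 0 = 0 := by
  rw [← germAt_zero, germDiff_germAt analyticAt_const]
  simp

/-- The pullback of germs along an analytic map. -/
def germPullback {q : W} (ψ : V → W) (hψ : AnalyticAt ℂ ψ p) (hq : ψ p = q) :
    HolGerm q →+* HolGerm p where
  toFun a := ⟨(a : Germ (𝓝 q) ℂ).compTendsto ψ (hq ▸ hψ.continuousAt), by
    obtain ⟨f, hf, h⟩ := a.2
    refine ⟨f ∘ ψ, AnalyticAt.comp (hq ▸ hf) hψ, ?_⟩
    rw [← h]
    rfl⟩
  map_one' := rfl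
  map_zero' := rfl
  map_mul' := by
    rintro ⟨a, f, hf, rfl⟩ ⟨b, g, hg, rfl⟩
    rfl
  map_add' := by
    rintro ⟨a, f, hf, rfl⟩ ⟨b, g, hg, rfl⟩
    rfl

lemma germPullback_germAt {q : W} {ψ : V → W} (hψ : AnalyticAt ℂ ψ p) (hq : ψ p = q)
    {f : W → ℂ} (hf : AnalyticAt ℂ f q) :
    germPullback ψ hψ hq (germAt f q) = germAt (fun x => f (ψ x)) p := by
  apply Subtype.ext
  rw [coe_germAt (f := fun x => f (ψ x)) (AnalyticAt.fun_comp (hq ▸ hf) hψ)]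
  change Germ.compTendsto (germAt f q : Germ (𝓝 q) ℂ) ψ
    (hq ▸ hψ.continuousAt : Tendsto ψ (𝓝 p) (𝓝 q)) = _
  simp_rw [coe_germAt hf]
  rfl

/-- Two pullbacks of a function along maps that agree at `p` are congruent modulo any ideal that
contains the linear coordinates of the difference of the two maps. -/
theorem germAt_comp_sub_mem [FiniteDimensional ℂ W] {w : W} {f : W → ℂ} (hf : AnalyticAt ℂ f w)
    {a b : V → W} (ha : AnalyticAt ℂ a p) (hb : AnalyticAt ℂ b p) (haw : a p = w) (hbw : b p = w)
    {J : Ideal (HolGerm p)} (hJ : ∀ ℓ : W →L[ℂ] ℂ, germAt (fun x => ℓ (a x - b x)) p ∈ J) :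
    germAt (fun x => f (a x)) p - germAt (fun x => f (b x)) p ∈ J := by
  have := FiniteDimensional.complete ℂ W
  obtain ⟨h, hh, he⟩ := exists_analyticAt_sub_eq hf
  let e := Module.finBasis ℂ W
  let c (i) : W →L[ℂ] ℂ := LinearMap.toContinuousLinearMap (e.coord i)
  have hab : AnalyticAt ℂ (fun x => (a x, b x)) p := ha.prod hb
  have hh' : AnalyticAt ℂ (fun x => h (a x, b x)) p :=
    AnalyticAt.fun_comp (g := h) (by simpa only [haw, hbw] using hh) hab
  have hi (i) : AnalyticAt ℂ (fun x => h (a x, b x) (e i)) p :=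
    ((ContinuousLinearMap.apply ℂ ℂ (e i)).analyticAt _).fun_comp hh'
  have hc (i) : AnalyticAt ℂ (fun x => c i (a x - b x)) p :=
    ((c i).analyticAt _).fun_comp (ha.fun_sub hb)
  have hev : ∀ᶠ x in 𝓝 p, f (a x) - f (b x) = ∑ i, c i (a x - b x) * h (a x, b x) (e i) := by
    have ht : Tendsto (fun x => (a x, b x)) (𝓝 p) (𝓝 (w, w)) := by
      simpa only [haw, hbw] using hab.continuousAt.tendsto
    filter_upwards [ht.eventually he] with x hx
    rw [hx]
    conv_lhs => rw [← e.sum_repr (a x - b x)]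
    simp [c]
  rw [← germAt_sub (AnalyticAt.fun_comp (haw ▸ hf) ha) (AnalyticAt.fun_comp (hbw ▸ hf) hb),
    germAt_congr hev, germAt_sum _ fun i => (hc i).fun_mul (hi i)]
  refine Ideal.sum_mem _ fun i _ => ?_
  rw [germAt_mul (hc i) (hi i)]
  exact J.mul_mem_right _ (hJ _)

/-- If `f` is not locally zero, then `f x ≠ 0` at some `x` in a ball of analyticity. Hence `g`
vanishes near `x`, and on the whole ball by the identity theorem. -/
lemma eventuallyEq_zero_of_mul {f g : V → ℂ} (hf : AnalyticAt ℂ f p) (hg : AnalyticAt ℂ g p)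
    (h : ∀ᶠ x in 𝓝 p, f x * g x = 0) : (∀ᶠ x in 𝓝 p, f x = 0) ∨ ∀ᶠ x in 𝓝 p, g x = 0 := by
  by_contra! hc
  obtain ⟨r, hr, hball⟩ := Metric.eventually_nhds_iff_ball.1
    (hf.eventually_analyticAt.and (hg.eventually_analyticAt.and h))
  obtain ⟨x, hx, hxb⟩ := (hc.1.and_eventually (Metric.ball_mem_nhds p hr)).exists
  have hb : Metric.ball p r ∈ 𝓝 x := Metric.isOpen_ball.mem_nhds hxb
  have hg0 : g =ᶠ[𝓝 x] 0 := by
    filter_upwards [(hball x hxb).1.continuousAt.eventually_ne hx, hb] with y hy hyb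
    exact (mul_eq_zero.1 (hball y hyb).2.2).resolve_left hy
  have han : AnalyticOnNhd ℂ g (Metric.ball p r) := fun y hy => (hball y hy).2.1
  have := han.eqOn_zero_of_preconnected_of_eventuallyEq_zero
    (convex_ball p r).isPreconnected hxb hg0
  exact hc.2 (Filter.mem_of_superset (Metric.ball_mem_nhds p hr) fun y hy => not_not.2 (this hy))

instance : IsDomain (HolGerm p) := by
  have : Nontrivial (HolGerm p) := (germEval p).domain_nontrivial
  have : NoZeroDivisors (HolGerm p) := ⟨by
    intro a b hab
    obtain ⟨f, hf, rfl⟩ := exists_germAt_eq a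
    obtain ⟨g, hg, rfl⟩ := exists_germAt_eq b
    rw [← germAt_mul hf hg, ← germAt_zero,
      germAt_eq_germAt (hf.fun_mul hg) analyticAt_const] at hab
    rw [← germAt_zero, germAt_eq_germAt hf analyticAt_const, germAt_eq_germAt hg analyticAt_const]
    exact eventuallyEq_zero_of_mul hf hg hab⟩
  exact NoZeroDivisors.to_isDomain _

end GermCalculus

/-! ### A lower bound for the dimension of the ring of germs. -/

section Dimension

/-- The projection of `ℂ^N` that annihilates the first `k` coordinates. -/
def dropCoords (N k : ℕ) : Cn N →L[ℂ] Cn N :=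
  ContinuousLinearMap.pi fun i => if (i : ℕ) < k then 0 else ContinuousLinearMap.proj i

lemma dropCoords_apply {N k : ℕ} (x : Cn N) (i : Fin N) :
    dropCoords N k x i = if (i : ℕ) < k then 0 else x i := by
  simp only [dropCoords, ContinuousLinearMap.coe_pi']
  split_ifs <;> rfl

lemma dropCoords_comp {N k l : ℕ} (h : k ≤ l) (x : Cn N) :
    dropCoords N k (dropCoords N l x) = dropCoords N l x := by
  ext i
  simp only [dropCoords_apply]
  split_ifs <;> first | rfl | omega

/-- The prime ideal of the germs at `0` that vanish on the common zeros of the first `k`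
coordinates. -/
def coordPrime (N k : ℕ) : PrimeSpectrum (HolGerm (0 : Cn N)) :=
  ⟨RingHom.ker (germPullback (q := (0 : Cn N)) (dropCoords N k)
    ((dropCoords N k).analyticAt 0) (map_zero _)), RingHom.ker_isPrime _⟩

lemma coordPrime_lt {N k : ℕ} (hk : k < N) : coordPrime N k < coordPrime N (k + 1) := by
  rw [← PrimeSpectrum.asIdeal_lt_asIdeal]
  refine lt_of_le_of_ne ?_ ?_
  · intro a ha
    obtain ⟨f, hf, rfl⟩ := exists_germAt_eq a
    change germPullback _ _ _ _ = 0 at ha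
    change germPullback _ _ _ _ = 0
    have hk : AnalyticAt ℂ (fun x => f (dropCoords N k x)) 0 :=
      AnalyticAt.fun_comp (by simpa using hf) ((dropCoords N k).analyticAt 0)
    have h := congrArg (germPullback (q := (0 : Cn N)) (dropCoords N (k + 1))
      ((dropCoords N (k + 1)).analyticAt 0) (map_zero _)) ha
    rw [map_zero, germPullback_germAt _ _ hf, germPullback_germAt _ _ hk] at h
    rw [germPullback_germAt _ _ hf, ← h]
    simp_rw [dropCoords_comp (Nat.le_succ k)]
  · intro h
    -- The coordinate of index `k`, counted from 0, separates the two primes: it is killed by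
    -- `dropCoords N (k + 1)` but not by `dropCoords N k`.
    let ℓ : Cn N →L[ℂ] ℂ := ContinuousLinearMap.proj ⟨k, hk⟩
    have h1 : germAt ℓ 0 ∈ (coordPrime N (k + 1)).asIdeal := by
      change germPullback _ _ _ _ = 0
      rw [germPullback_germAt _ _ (ℓ.analyticAt 0), ← germAt_zero]
      congr 1
      funext x
      simp [ℓ, dropCoords_apply]
    rw [← h] at h1
    change germPullback _ _ _ _ = 0 at h1
    rw [germPullback_germAt _ _ (ℓ.analyticAt 0), ← germAt_zero] at h1
    have h2 : (fun x => ℓ (dropCoords N k x)) = ℓ := by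
      funext x
      simp [ℓ, dropCoords_apply]
    rw [h2] at h1
    have h3 := congrArg (germDiff (0 : Cn N)) h1
    rw [germDiff_germAt (ℓ.analyticAt 0), germDiff_germAt analyticAt_const] at h3
    have h4 := DFunLike.congr_fun h3 (Pi.single ⟨k, hk⟩ 1)
    simp [ℓ] at h4

/-- The dimension of `𝒪_{ℂ^N,0}` is at least `N`. -/
theorem le_ringKrullDim_holGerm (N : ℕ) : (N : WithBot ℕ∞) ≤ ringKrullDim (HolGerm (0 : Cn N)) := by
  let c : LTSeries (PrimeSpectrum (HolGerm (0 : Cn N))) :=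
    { length := N
      toFun := fun i => coordPrime N i
      step := fun i => coordPrime_lt i.2 }
  exact Order.LTSeries.length_le_krullDim c

end Dimension

/-! ### Nonzero ideals of second order have non-regular quotients. -/

section NonRegular

variable {V : Type*} [NormedAddCommGroup V] [NormedSpace ℂ V] {p : V}

lemma analyticAt_clm_sub (μ : V →L[ℂ] ℂ) (p : V) : AnalyticAt ℂ (fun x => μ (x - p)) p :=
  (μ.analyticAt _).fun_comp (analyticAt_id.fun_sub analyticAt_const)

/-- The germ at `p` of the linear coordinate `x ↦ μ (x - p)`. -/
def linGerm (p : V) : (V →L[ℂ] ℂ) →ₗ[ℂ] HolGerm p where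
  toFun μ := germAt (fun x => μ (x - p)) p
  map_add' μ ν := germAt_add (analyticAt_clm_sub μ p) (analyticAt_clm_sub ν p)
  map_smul' c μ := (germAt_mul analyticAt_const (analyticAt_clm_sub μ p)).trans <| by
    rw [RingHom.id_apply, Algebra.smul_def]
    congr 1
    exact Subtype.ext (coe_germAt analyticAt_const)

lemma linGerm_apply (μ : V →L[ℂ] ℂ) : linGerm p μ = germAt (fun x => μ (x - p)) p := rfl

lemma germEval_linGerm (μ : V →L[ℂ] ℂ) : germEval p (linGerm p μ) = 0 := by
  rw [linGerm_apply, germEval_germAt (analyticAt_clm_sub μ p)]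
  simp

lemma germDiff_linGerm (μ : V →L[ℂ] ℂ) : germDiff p (linGerm p μ) = μ := by
  rw [linGerm_apply, germDiff_germAt (analyticAt_clm_sub μ p)]
  have : HasFDerivAt (fun x => μ (x - p)) (μ.comp (ContinuousLinearMap.id ℂ V)) p :=
    μ.hasFDerivAt.comp p ((hasFDerivAt_id p).sub_const p)
  exact this.fderiv

/-- A holomorphic function that vanishes on no neighbourhood of `p` does not vanish identically
on some line through `p`. -/
lemma exists_line_not_eventually_zero {f : V → ℂ} (hf : AnalyticAt ℂ f p)
    (h0 : ¬ ∀ᶠ x in 𝓝 p, f x = 0) : ∃ v : V, ¬ ∀ᶠ z in 𝓝 (0 : ℂ), f (p + z • v) = 0 := by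
  obtain ⟨r, hr, hball⟩ := Metric.eventually_nhds_iff_ball.1 hf.eventually_analyticAt
  obtain ⟨x, hx, hxb⟩ := ((not_eventually.1 h0).and_eventually
    (Metric.ball_mem_nhds p hr)).exists
  refine ⟨x - p, fun h => hx ?_⟩
  let A : ℂ → V := fun z => p + z • (x - p)
  have hA (z : ℂ) : AnalyticAt ℂ A z := by fun_prop
  have hconn : IsPreconnected {z : ℂ | A z ∈ Metric.ball p r} := by
    have := ((convex_ball (0 : V) r).linear_preimage
      ((ContinuousLinearMap.toSpanSingleton ℂ (x - p)).restrictScalars ℝ :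
        ℂ →ₗ[ℝ] V)).isPreconnected
    convert this using 1
    ext z
    simp [A]
  have han : AnalyticOnNhd ℂ (fun z => f (A z)) {z : ℂ | A z ∈ Metric.ball p r} := fun z hz =>
    (hball _ hz).fun_comp (hA z)
  have := han.eqOn_zero_of_preconnected_of_eventuallyEq_zero hconn
    (z₀ := 0) (by simp [A, hr]) h (x := 1) (by simpa [A, dist_eq_norm] using hxb)
  simpa [A] using this

/-- If the ideal `P` is prime and contains a germ that does not vanish on the line `p + ℂ v`, and
all linear coordinates that vanish on this line, then it contains the maximal ideal. -/
lemma ker_germEval_le_of_isPrime [FiniteDimensional ℂ V] {f : V → ℂ} (hf : AnalyticAt ℂ f p)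
    {v : V} (hv : ¬ ∀ᶠ z in 𝓝 (0 : ℂ), f (p + z • v) = 0) {ℓ : V →L[ℂ] ℂ} (hℓ : ℓ v = 1)
    {P : Ideal (HolGerm p)} [hP : P.IsPrime] (hfP : germAt f p ∈ P)
    (hlin : ∀ μ : V →L[ℂ] ℂ, μ v = 0 → linGerm p μ ∈ P) : RingHom.ker (germEval p) ≤ P := by
  have hA : AnalyticAt ℂ (fun z : ℂ => p + z • v) 0 := by fun_prop
  have hu : AnalyticAt ℂ (fun z : ℂ => f (p + z • v)) 0 :=
    AnalyticAt.fun_comp (by simpa using hf) hA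
  -- On the line, `f` is `z ^ d` times a unit. Modulo `P` every point `x` may be replaced by its
  -- projection `p + ℓ (x - p) • v` to the line, so `P` contains a power of the coordinate `ℓ`.
  obtain ⟨d, w, hw, hw0, he⟩ := hu.exists_eventuallyEq_pow_smul_nonzero_iff.2 hv
  have hL := analyticAt_clm_sub ℓ p
  have hL0 : ℓ (p - p) = 0 := by simp
  have hb : AnalyticAt ℂ (fun x => p + ℓ (x - p) • v) p :=
    analyticAt_const.fun_add (hL.fun_smul analyticAt_const)
  have hdecomp (μ : V →L[ℂ] ℂ) : linGerm p (μ - μ v • ℓ) ∈ P := hlin _ (by simp [hℓ])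
  have h1 : germAt (fun x => f (p + ℓ (x - p) • v)) p ∈ P := by
    have := germAt_comp_sub_mem (J := P) hf (a := fun x => x) analyticAt_id hb rfl (by simp)
      (fun μ => by
        convert hdecomp μ using 1
        rw [linGerm_apply]
        congr 1
        funext x
        simp only [map_sub, map_add, map_smul, sub_apply,
          smul_apply, smul_eq_mul]
        ring)
    simpa using P.sub_mem hfP this
  have hwL : AnalyticAt ℂ (fun x => w (ℓ (x - p))) p :=
    AnalyticAt.fun_comp (by rwa [hL0]) hL
  have h2 : linGerm p ℓ ^ d * germAt (fun x => w (ℓ (x - p))) p ∈ P := by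
    rw [linGerm_apply, ← germAt_pow hL, ← germAt_mul (hL.fun_pow d) hwL]
    convert h1 using 1
    apply germAt_congr
    have ht : Tendsto (fun x => ℓ (x - p)) (𝓝 p) (𝓝 0) := by
      simpa using hL.continuousAt.tendsto
    filter_upwards [ht.eventually he] with x hx
    rw [hx]
    simp
  have h3 : linGerm p ℓ ∈ P := by
    refine hP.mem_of_pow_mem d ?_
    have h4 := P.mul_mem_right (germAt (fun x => (w (ℓ (x - p)))⁻¹) p) h2
    rwa [mul_assoc, ← germAt_mul hwL (hwL.fun_inv (by rwa [hL0])), germAt_congr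
      (g := fun _ => 1), germAt_one, mul_one] at h4
    filter_upwards [hwL.continuousAt.eventually_ne (by rwa [hL0])] with x hx
    exact mul_inv_cancel₀ hx
  have h5 (μ : V →L[ℂ] ℂ) : linGerm p μ ∈ P := by
    have : μ = (μ - μ v • ℓ) + μ v • ℓ := by abel
    rw [this, map_add, map_smul, Algebra.smul_def]
    exact P.add_mem (hdecomp μ) (P.mul_mem_left _ h3)
  -- Now `P` contains all linear coordinates at `p`; Hadamard's lemma with the constant map `p`
  -- gives every germ that vanishes at `p`.
  intro a ha
  obtain ⟨g, hg, rfl⟩ := exists_germAt_eq a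
  rw [RingHom.mem_ker, germEval_germAt hg] at ha
  have := germAt_comp_sub_mem (J := P) hg (a := fun x => x) (b := fun _ => p) analyticAt_id
    analyticAt_const rfl rfl h5
  rwa [ha, germAt_zero, sub_zero] at this

/-- The quotient of `𝒪_{V,p}` by a nonzero ideal of germs that vanish to second order is not
regular. -/
theorem not_isRegularLocalRing_quotient [FiniteDimensional ℂ V] {I : Ideal (HolGerm p)}
    (hI0 : I ≠ ⊥) (hev : ∀ a ∈ I, germEval p a = 0) (hdiff : ∀ a ∈ I, germDiff p a = 0) :
    ¬ IsRegularLocalRing (HolGerm p ⧸ I) := by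
  intro hreg
  let q := Ideal.Quotient.mk I
  let 𝔪 := IsLocalRing.maximalIdeal (HolGerm p ⧸ I)
  have hq : Function.Surjective q := Ideal.Quotient.mk_surjective
  have hm (a : HolGerm p) : q a ∈ 𝔪 ↔ germEval p a = 0 := by
    let e : HolGerm p ⧸ I →+* ℂ := Ideal.Quotient.lift I (germEval p) hev
    have hes : Function.Surjective e := Ideal.Quotient.lift_surjective_of_surjective _ _
      (germEval_surjective p)
    have := RingHom.ker_isMaximal_of_surjective e hes
    have h𝔪 : 𝔪 = RingHom.ker e := (IsLocalRing.eq_maximalIdeal this).symm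
    rw [h𝔪, RingHom.mem_ker]
    rfl
  obtain ⟨a, haI, ha0⟩ := (Submodule.ne_bot_iff I).1 hI0
  obtain ⟨f, hf, rfl⟩ := exists_germAt_eq a
  have hf0 : ¬ ∀ᶠ x in 𝓝 p, f x = 0 := by
    rwa [Ne, ← germAt_zero, germAt_eq_germAt hf analyticAt_const] at ha0
  obtain ⟨v, hv⟩ := exists_line_not_eventually_zero hf hf0
  have hfp : f p = 0 := by rw [← germEval_germAt hf]; exact hev _ haI
  have hv0 : v ≠ 0 := by
    rintro rfl
    exact hv (by simp [hfp])
  obtain ⟨ℓ, hℓ⟩ := SeparatingDual.exists_eq_one (R := ℂ) hv0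
  -- The linear forms vanishing on a line where `f` does not: they supply `dim V - 1` elements over
  -- which the maximal ideal of the quotient is minimal. Krull's height theorem then bounds the
  -- dimension; the Noetherian property it requires is part of the assumed regularity.
  let A : Submodule ℂ (V →L[ℂ] ℂ) :=
    LinearMap.ker (ContinuousLinearMap.apply ℂ ℂ v : (V →L[ℂ] ℂ) →ₗ[ℂ] ℂ)
  have hAr : Module.finrank ℂ A + 1 = Module.finrank ℂ (V →L[ℂ] ℂ) := by
    have hsurj : LinearMap.range (ContinuousLinearMap.apply ℂ ℂ v : (V →L[ℂ] ℂ) →ₗ[ℂ] ℂ) = ⊤ := by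
      rw [LinearMap.range_eq_top]
      intro c
      exact ⟨c • ℓ, by simp [hℓ]⟩
    have := LinearMap.finrank_range_add_finrank_ker
      (ContinuousLinearMap.apply ℂ ℂ v : (V →L[ℂ] ℂ) →ₗ[ℂ] ℂ)
    rw [hsurj, finrank_top, Module.finrank_self] at this
    rw [← this, add_comm]
  classical
  have : Module.Free ℂ A := Module.Free.of_divisionRing ℂ A
  let b := Module.finBasis ℂ A
  let s : Finset (HolGerm p ⧸ I) := Finset.univ.image fun i => q (linGerm p (b i))
  have hmin : 𝔪 ∈ (Ideal.span (s : Set (HolGerm p ⧸ I))).minimalPrimes := by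
    refine ⟨⟨inferInstance, ?_⟩, ?_⟩
    · rw [Ideal.span_le]
      intro y hy
      simp only [s, Finset.coe_image, Set.mem_image] at hy
      obtain ⟨i, -, rfl⟩ := hy
      exact (hm _).2 (germEval_linGerm _)
    · rintro Q ⟨hQ, hsQ⟩ - y hy
      obtain ⟨a, rfl⟩ := hq y
      have hbP (i) : linGerm p (b i) ∈ Q.comap q :=
        hsQ (Ideal.subset_span (by simp [s]))
      have := hQ.comap q
      refine ker_germEval_le_of_isPrime (P := Q.comap q) hf hv hℓ ?_ ?_ ((hm a).1 hy)
      · rw [Ideal.mem_comap, Ideal.Quotient.eq_zero_iff_mem.2 haI]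
        exact Q.zero_mem
      · intro μ hμ
        have h1 : μ = ∑ i, b.repr ⟨μ, hμ⟩ i • (b i : V →L[ℂ] ℂ) := by
          have := congrArg A.subtype (b.sum_repr ⟨μ, hμ⟩)
          rw [map_sum] at this
          exact this.symm
        rw [h1, map_sum]
        refine Ideal.sum_mem _ fun i _ => ?_
        rw [map_smul, Algebra.smul_def]
        exact Ideal.mul_mem_left _ _ (hbP i)
  have hheight := Ideal.height_le_card_of_mem_minimalPrimes_span_finset hmin
  have hcard : s.card ≤ Module.finrank ℂ A :=
    Finset.card_image_le.trans (by simp)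
  have hdim : 𝔪.spanFinrank ≤ Module.finrank ℂ A := by
    have h1 : ((𝔪.spanFinrank : ℕ∞) : WithBot ℕ∞) = 𝔪.height :=
      (IsRegularLocalRing.spanFinrank_maximalIdeal (R := HolGerm p ⧸ I)).trans
        IsLocalRing.maximalIdeal_height_eq_ringKrullDim.symm
    have h2 : (𝔪.spanFinrank : ℕ∞) = 𝔪.height := by exact_mod_cast h1
    have h3 := h2 ▸ hheight
    exact (by exact_mod_cast h3 : 𝔪.spanFinrank ≤ s.card).trans hcard
  -- Conversely, differentials are well defined modulo `I`, and by the Leibniz rule those of any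
  -- generators of the maximal ideal span the whole dual of `V`. So at least `dim V` generators are
  -- needed.
  obtain ⟨u, hu, hspan⟩ :=
    Submodule.FG.exists_span_finset_card_eq_spanFinrank (IsNoetherian.noetherian 𝔪)
  choose g hg using hq
  let T : Submodule ℂ (V →L[ℂ] ℂ) := Submodule.span ℂ (u.image fun y => germDiff p (g y) : Finset _)
  have hwd (a b : HolGerm p) (h : q a = q b) : germDiff p a = germDiff p b := by
    have h1 := hdiff _ (Ideal.Quotient.eq.1 h)
    have h2 := germDiff_add (a - b) b
    rwa [sub_add_cancel, h1, zero_add] at h2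
  have hT : ∀ y ∈ Submodule.span (HolGerm p ⧸ I) (u : Set (HolGerm p ⧸ I)),
      germDiff p (g y) ∈ T := by
    intro y hy
    induction hy using Submodule.span_induction with
    | mem y hy => exact Submodule.subset_span (by simpa using ⟨y, hy, rfl⟩)
    | zero =>
      rw [hwd _ 0 ((hg 0).trans (map_zero q).symm), germDiff_zero]
      exact T.zero_mem
    | add y z _ _ hy hz =>
      rw [hwd _ (g y + g z) (by rw [map_add, hg, hg, hg]), germDiff_add]
      exact T.add_mem hy hz
    | smul c y hys hy =>
      rw [hwd _ (g c * g y) (by rw [map_mul, hg, hg, hg, smul_eq_mul]), germDiff_mul]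
      rw [hspan, ← hg y, hm] at hys
      have h0 : (0 : ℂ) • germDiff p (g c) = 0 := by ext; simp
      rw [hys, h0, add_zero]
      exact T.smul_mem _ hy
  have htop : T = ⊤ := by
    rw [eq_top_iff]
    intro μ _
    have h1 := hT (q (linGerm p μ)) (by rw [hspan, hm]; exact germEval_linGerm μ)
    rwa [hwd _ (linGerm p μ) (hg _), germDiff_linGerm] at h1
  have hfin : Module.finrank ℂ T ≤ u.card :=
    (finrank_span_finset_le_card _).trans Finset.card_image_le
  rw [htop, finrank_top] at hfin
  omega

end NonRegular

/-! ### Rank, minors and the derivative of the determinant. -/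

section Minors

lemma exists_orderEmb_linearIndependent {K E : Type*} [Field K] [AddCommGroup E] [Module K E]
    [FiniteDimensional K E] {m r : ℕ} (v : Fin m → E)
    (hr : r ≤ Module.finrank K (Submodule.span K (Set.range v))) :
    ∃ R : Fin r ↪o Fin m, LinearIndependent K (v ∘ R) := by
  classical
  obtain ⟨κ, a, ha, hspan, hli⟩ := exists_linearIndependent' K v
  have : Finite κ := Finite.of_injective a ha
  have := Fintype.ofFinite κ
  have hcard : Module.finrank K (Submodule.span K (Set.range v)) = Fintype.card κ := by
    rw [← hspan]
    exact finrank_span_eq_card hli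
  let s : Finset (Fin m) := Finset.univ.image a
  have hs : s.card = Fintype.card κ := Finset.card_image_of_injective _ ha
  obtain ⟨s', hs', hc⟩ := Finset.exists_subset_card_eq (s := s) (n := r) (by omega)
  let R := s'.orderEmbOfFin hc
  refine ⟨R, ?_⟩
  have hR (i) : ∃ k, a k = R i := by
    have := hs' (s'.orderEmbOfFin_mem hc i)
    simpa [s] using this
  choose k hk using hR
  have : v ∘ R = (v ∘ a) ∘ k := by
    funext i
    simp [hk]
  rw [this]
  refine hli.comp k fun i j hij => R.injective ?_
  rw [← hk, ← hk, hij]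

lemma exists_minor_ne_zero {K : Type*} [Field K] {m n r : ℕ} (A : Matrix (Fin m) (Fin n) K)
    (hr : r ≤ A.rank) :
    ∃ (R : Fin r ↪o Fin m) (C : Fin r ↪o Fin n), (A.submatrix R C).det ≠ 0 := by
  rw [A.rank_eq_finrank_span_row] at hr
  obtain ⟨R, hR⟩ := exists_orderEmb_linearIndependent A.row hr
  have h1 : (A.submatrix R id).rank = r := by
    have : LinearIndependent K (A.submatrix R id).row := hR
    simpa using this.rank_matrix
  have h2 := h1.ge
  rw [Matrix.rank_eq_finrank_span_cols] at h2
  obtain ⟨C, hC⟩ := exists_orderEmb_linearIndependent (A.submatrix R id).col h2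
  refine ⟨R, C, ?_⟩
  have h3 : LinearIndependent K (A.submatrix R C).col := hC
  rw [Matrix.linearIndependent_cols_iff_isUnit, Matrix.isUnit_iff_isUnit_det] at h3
  exact h3.ne_zero

lemma le_rank_of_minor_ne_zero {K : Type*} [Field K] {m n r : ℕ} {A : Matrix (Fin m) (Fin n) K}
    {R : Fin r → Fin m} {C : Fin r → Fin n} (h : (A.submatrix R C).det ≠ 0) : r ≤ A.rank := by
  have h1 : (A.submatrix R C).rank = r := by
    rw [Matrix.rank_of_isUnit _ ((Matrix.isUnit_iff_isUnit_det _).2 h.isUnit), Fintype.card_fin]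
  rw [← h1]
  exact Matrix.rank_submatrix_le _ _ _

lemma rank_lt_iff_minors_eq_zero {K : Type*} [Field K] {m n r : ℕ}
    {A : Matrix (Fin m) (Fin n) K} :
    A.rank < r ↔ ∀ (R : Fin r ↪o Fin m) (C : Fin r ↪o Fin n), (A.submatrix R C).det = 0 := by
  constructor
  · intro h R C
    by_contra hne
    exact absurd (le_rank_of_minor_ne_zero hne) (not_le.2 h)
  · intro h
    by_contra! hle
    obtain ⟨R, C, hne⟩ := exists_minor_ne_zero A hle
    exact hne (h R C)

lemma rank_add_le {K ι κ : Type*} [Field K] [Fintype ι] [Fintype κ] (A B : Matrix ι κ K) :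
    (A + B).rank ≤ A.rank + B.rank := by
  rw [Matrix.rank, Matrix.mulVecLin_add]
  exact (Submodule.finrank_mono (LinearMap.range_add_le _ _)).trans
    (Submodule.finrank_add_le_finrank_add_finrank _ _)

/-- Replacing a row is a perturbation of rank at most 1, so the rank stays below `t`. -/
lemma det_updateRow_eq_zero {K : Type*} [Field K] {t : ℕ} {B : Matrix (Fin t) (Fin t) K}
    (hB : B.rank + 2 ≤ t) (i : Fin t) (v : Fin t → K) : (B.updateRow i v).det = 0 := by
  have h : B.updateRow i v = B + Matrix.vecMulVec (Pi.single i 1) (v - B i) := by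
    ext j k
    by_cases hj : j = i
    · subst hj
      simp [Matrix.vecMulVec_apply]
    · simp [Matrix.vecMulVec_apply, hj]
  by_contra hne
  have h1 : t ≤ (B.updateRow i v).rank :=
    le_rank_of_minor_ne_zero (R := id) (C := id) (by simpa using hne)
  rw [h] at h1
  have h2 := rank_add_le B (Matrix.vecMulVec (Pi.single i 1) (v - B i))
  have h3 := Matrix.rank_vecMulVec_le (Pi.single i 1) (v - B i)
  omega

variable {V : Type*} [NormedAddCommGroup V] [NormedSpace ℂ V] {p : V}

lemma analyticAt_det {ι : Type*} [Fintype ι] [DecidableEq ι] {B : V → Matrix ι ι ℂ}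
    (hB : ∀ i j, AnalyticAt ℂ (fun x => B x i j) p) : AnalyticAt ℂ (fun x => (B x).det) p := by
  simp_rw [Matrix.det_apply']
  exact Finset.analyticAt_fun_sum _ fun σ _ => analyticAt_const.fun_mul
    (Finset.analyticAt_fun_prod _ fun i _ => hB _ _)

/-- The determinant vanishes to second order at matrices of corank at least `2`. -/
lemma fderiv_det_eq_zero {t : ℕ} {B : V → Matrix (Fin t) (Fin t) ℂ}
    (hB : ∀ i j, AnalyticAt ℂ (fun x => B x i j) p) (hr : (B p).rank + 2 ≤ t) :
    fderiv ℂ (fun x => (B x).det) p = 0 := by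
  let D : ContinuousMultilinearMap ℂ (fun _ : Fin t => Fin t → ℂ) ℂ :=
    { toMultilinearMap := (Matrix.detRowAlternating (n := Fin t) (R := ℂ)).toMultilinearMap
      cont := by
        change Continuous fun M : Fin t → Fin t → ℂ => (Matrix.of M).det
        exact Continuous.matrix_det (by fun_prop) }
  let B' : V → Fin t → Fin t → ℂ := fun x i j => B x i j
  -- The derivative of a multilinear map is a sum of terms with one argument, here one row,
  -- replaced.
  have hD : D.linearDeriv (B' p) = 0 := by
    refine ContinuousLinearMap.ext fun y => ?_
    rw [ContinuousMultilinearMap.linearDeriv_apply]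
    exact Finset.sum_eq_zero fun i _ => det_updateRow_eq_zero hr i (y i)
  have hB' : DifferentiableAt ℂ B' p :=
    differentiableAt_pi.2 fun i => differentiableAt_pi.2 fun j => (hB i j).differentiableAt
  have h1 : HasFDerivAt (fun x => D (B' x)) ((D.linearDeriv (B' p)).comp (fderiv ℂ B' p)) p :=
    (D.hasFDerivAt (B' p)).comp p hB'.hasFDerivAt
  rw [hD, ContinuousLinearMap.zero_comp] at h1
  exact h1.fderiv

end Minors

/-! ### Points of rank below `t - 1`. -/

section DeterminantalPoints

variable {N m n t : ℕ}

lemma analyticAt_entry {V : Type*} [NormedAddCommGroup V] [NormedSpace ℂ V] {p : V}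
    {F : V → Mat m n} (hF : AnalyticAt ℂ F p) (i : Fin m) (j : Fin n) :
    AnalyticAt ℂ (fun x => F x i j) p := by
  have := analyticAt_pi_iff.1 hF i
  exact analyticAt_pi_iff.1 this j

lemma analyticAt_minor {V : Type*} [NormedAddCommGroup V] [NormedSpace ℂ V] {p : V}
    {F : V → Mat m n} (hF : AnalyticAt ℂ F p) {r : ℕ} (R : Fin r → Fin m) (C : Fin r → Fin n) :
    AnalyticAt ℂ (fun x => ((Matrix.of (F x)).submatrix R C).det) p :=
  analyticAt_det fun _ _ => analyticAt_entry hF _ _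

/-- A point at which the rank drops below `t - 1` is a singular point, as soon as one of the
`t`-minors does not vanish identically near this point. -/
theorem isSingularAt_of_rank_lt {F : Cn N → Mat m n} {p : Cn N} (hF : AnalyticAt ℂ F p)
    (hp : F p ∈ genericDet m n (t - 1)) {R : Fin t ↪o Fin m} {C : Fin t ↪o Fin n}
    (hne : ¬ ∀ᶠ x in 𝓝 p, ((Matrix.of (F x)).submatrix R C).det = 0) : IsSingularAt t F p := by
  -- With truncated subtraction this forces `t ≥ 2`.
  have hrk : (Matrix.of (F p)).rank < t - 1 := hp
  refine ⟨show (Matrix.of (F p)).rank < t by omega, ?_⟩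
  have hgen : ∀ (R : Fin t ↪o Fin m) (C : Fin t ↪o Fin n),
      germEval p (germAt (fun x => ((Matrix.of (F x)).submatrix R C).det) p) = 0 ∧
      germDiff p (germAt (fun x => ((Matrix.of (F x)).submatrix R C).det) p) = 0 := by
    intro R C
    rw [germEval_germAt (analyticAt_minor hF R C), germDiff_germAt (analyticAt_minor hF R C)]
    refine ⟨rank_lt_iff_minors_eq_zero.1 (by omega) R C,
      fderiv_det_eq_zero (fun _ _ => analyticAt_entry hF _ _) ?_⟩
    have := Matrix.rank_submatrix_le (Matrix.of (F p)) R C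
    omega
  have hI : ∀ a ∈ minorIdeal t F p, germEval p a = 0 ∧ germDiff p a = 0 := by
    intro a ha
    induction ha using Submodule.span_induction with
    | mem a ha =>
      obtain ⟨R, C, rfl⟩ := ha
      exact hgen R C
    | zero => exact ⟨map_zero _, germDiff_zero⟩
    | add a b _ _ ha hb => exact ⟨by rw [map_add, ha.1, hb.1, add_zero], by
        rw [germDiff_add, ha.2, hb.2, add_zero]⟩
    | smul c a _ ha => exact ⟨by rw [smul_eq_mul, map_mul, ha.1, mul_zero], by
        rw [smul_eq_mul, germDiff_mul, ha.1, ha.2]; ext; simp⟩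
  refine not_isRegularLocalRing_quotient ?_ (fun a ha => (hI a ha).1) fun a ha => (hI a ha).2
  intro hbot
  apply hne
  have h1 : germAt (fun x => ((Matrix.of (F x)).submatrix R C).det) p ∈ minorIdeal t F p :=
    Ideal.subset_span ⟨R, C, rfl⟩
  rw [hbot, Ideal.mem_bot, ← germAt_zero,
    germAt_eq_germAt (analyticAt_minor hF R C) analyticAt_const] at h1
  exact h1

/-- At a determinantal singularity some `t`-minor is not identically zero. -/
lemma IsDeterminantal.exists_minor_not_eventually_zero {F : Cn N → Mat m n}
    (hX : IsDeterminantal t F) : ∃ (R : Fin t ↪o Fin m) (C : Fin t ↪o Fin n),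
      ¬ ∀ᶠ x in 𝓝 0, ((Matrix.of (F x)).submatrix R C).det = 0 := by
  by_contra! h
  have hbot : minorIdeal t F 0 = ⊥ := by
    rw [minorIdeal, Ideal.span_eq_bot]
    rintro _ ⟨R, C, rfl⟩
    rw [← germAt_zero, germAt_eq_germAt (analyticAt_minor hX.analytic R C) analyticAt_const]
    exact h R C
  have hdim : ringKrullDim (detLocalRing t F 0) = ringKrullDim (HolGerm (0 : Cn N)) :=
    ringKrullDim_eq_of_ringEquiv ((Ideal.quotEquivOfEq hbot).trans (RingEquiv.quotientBot _))
  have h1 := hX.codim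
  rw [hdim] at h1
  have h2 := le_ringKrullDim_holGerm N
  -- The expected codimension is positive, which contradicts a local ring of dimension at least `N`.
  have h3 : 1 ≤ (m - t + 1) * (n - t + 1) := Nat.mul_pos (Nat.succ_pos _) (Nat.succ_pos _)
  have h4 : ((N + 1 : ℕ) : WithBot ℕ∞) ≤ (N : ℕ) := by
    rw [← h1, Nat.cast_add]
    refine add_le_add h2 ?_
    exact_mod_cast h3
  have h5 : N + 1 ≤ N := by exact_mod_cast h4
  omega

lemma analyticAt_versalFamily {τ : ℕ} {F : Cn N → Mat m n} {G : Fin τ → Cn N → Mat m n}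
    {p : Cn N} (hF : AnalyticAt ℂ F p) (hG : ∀ i, AnalyticAt ℂ (G i) p) (s : Cn τ) :
    AnalyticAt ℂ (versalFamily F G s) p :=
  hF.fun_add (Finset.analyticAt_fun_sum _ fun i _ => analyticAt_const.fun_smul (hG i))

/-- On suitable neighbourhoods, the matrices of the family are holomorphic and one of their
`t`-minors vanishes identically near no point. -/
lemma exists_nhds_versalFamily {τ : ℕ} {F : Cn N → Mat m n} {G : Fin τ → Cn N → Mat m n}
    (hX : IsDeterminantal t F) (hG : ∀ i, AnalyticAt ℂ (G i) 0) :
    ∃ U ∈ 𝓝 (0 : Cn N), ∃ S ∈ 𝓝 (0 : Cn τ), ∃ (R : Fin t ↪o Fin m) (C : Fin t ↪o Fin n),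
      ∀ s ∈ S, ∀ p ∈ U, AnalyticAt ℂ (versalFamily F G s) p ∧
        ¬ ∀ᶠ x in 𝓝 p, ((Matrix.of (versalFamily F G s x)).submatrix R C).det = 0 := by
  obtain ⟨R, C, hne⟩ := hX.exists_minor_not_eventually_zero
  obtain ⟨r, hr, hball⟩ := Metric.eventually_nhds_iff_ball.1
    (hX.analytic.eventually_analyticAt.and
      (Filter.eventually_all.2 fun i => (hG i).eventually_analyticAt))
  obtain ⟨x₀, hx₀, hxb⟩ := ((not_eventually.1 hne).and_eventually
    (Metric.ball_mem_nhds 0 hr)).exists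
  -- One test point `x₀` serves all fibres: the minor is nonzero there for `s = 0`, hence for small
  -- `s`. By the identity theorem it then vanishes identically near no point of the ball.
  let d : Cn τ → ℂ := fun s => ((Matrix.of (versalFamily F G s x₀)).submatrix R C).det
  have hd : Continuous d := by
    refine Continuous.matrix_det ?_
    refine continuous_matrix fun i j => ?_
    simp only [versalFamily, Matrix.submatrix_apply, Matrix.of_apply, Pi.add_apply,
      Finset.sum_apply, Pi.smul_apply]
    fun_prop
  have hd0 : d 0 ≠ 0 := by simpa [d, versalFamily] using hx₀
  refine ⟨_, Metric.ball_mem_nhds 0 hr, {s | d s ≠ 0}, hd.continuousAt.eventually_ne hd0, R, C, ?_⟩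
  intro s hs p hp
  have han : ∀ y ∈ Metric.ball (0 : Cn N) r, AnalyticAt ℂ (versalFamily F G s) y := fun y hy =>
    analyticAt_versalFamily (hball y hy).1 (hball y hy).2 s
  refine ⟨han p hp, fun h0 => hs ?_⟩
  have hon : AnalyticOnNhd ℂ
      (fun x => ((Matrix.of (versalFamily F G s x)).submatrix R C).det) (Metric.ball 0 r) :=
    fun y hy => analyticAt_minor (han y hy) R C
  exact hon.eqOn_zero_of_preconnected_of_eventuallyEq_zero
    (convex_ball _ _).isPreconnected hp h0 hxb

end DeterminantalPoints

/-! ### The ideal of minors at points of rank `t - 1`. -/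

section GenericRank

variable {N m n t r : ℕ}

lemma exists_orderEmb_comp_perm {f : Fin t → Fin m} (hf : Function.Injective f) :
    ∃ (R : Fin t ↪o Fin m) (σ : Equiv.Perm (Fin t)), f = R ∘ σ := by
  refine ⟨OrderEmbedding.ofStrictMono (f ∘ Tuple.sort f)
    ((Tuple.monotone_sort f).strictMono_of_injective (hf.comp (Tuple.sort f).injective)),
    (Tuple.sort f)⁻¹, ?_⟩
  funext i
  simp

/-- The minors for arbitrary choices of rows and columns belong to the ideal of minors. -/
lemma germAt_minor_mem {ι : Type*} [Fintype ι] [DecidableEq ι] (e : ι ≃ Fin t)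
    {F : Cn N → Mat m n} {p : Cn N} (hF : AnalyticAt ℂ F p) (f : ι → Fin m) (g : ι → Fin n) :
    germAt (fun x => ((Matrix.of (F x)).submatrix f g).det) p ∈ minorIdeal t F p := by
  have hre (A : Matrix (Fin m) (Fin n) ℂ) : (A.submatrix f g).det =
      (A.submatrix (f ∘ e.symm) (g ∘ e.symm)).det := by
    rw [← Matrix.det_submatrix_equiv_self e.symm (A.submatrix f g)]
    rfl
  simp_rw [hre]
  have hzero : ∀ (f : Fin t → Fin m) (g : Fin t → Fin n),
      (¬ Function.Injective f ∨ ¬ Function.Injective g) →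
      germAt (fun x => ((Matrix.of (F x)).submatrix f g).det) p ∈ minorIdeal t F p := by
    intro f g h
    have h0 (A : Matrix (Fin m) (Fin n) ℂ) : (A.submatrix f g).det = 0 := by
      rcases h with h | h
      · obtain ⟨i, j, hij, hne⟩ := Function.not_injective_iff.1 h
        exact Matrix.det_zero_of_row_eq hne (by funext k; simp [hij])
      · obtain ⟨i, j, hij, hne⟩ := Function.not_injective_iff.1 h
        exact Matrix.det_zero_of_column_eq hne (by intro k; simp [hij])
    simp_rw [h0]
    rw [germAt_zero]
    exact Ideal.zero_mem _
  by_cases hf : Function.Injective (f ∘ e.symm)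
  swap
  · exact hzero _ _ (Or.inl hf)
  by_cases hg : Function.Injective (g ∘ e.symm)
  swap
  · exact hzero _ _ (Or.inr hg)
  obtain ⟨R, σ, hR⟩ := exists_orderEmb_comp_perm hf
  obtain ⟨C, θ, hC⟩ := exists_orderEmb_comp_perm hg
  rw [hR, hC]
  have hperm (A : Matrix (Fin m) (Fin n) ℂ) : (A.submatrix (R ∘ σ) (C ∘ θ)).det =
      ((Equiv.Perm.sign σ : ℤ) : ℂ) * ((Equiv.Perm.sign θ : ℤ) : ℂ) * (A.submatrix R C).det := by
    have h1 := Matrix.det_permute σ ((A.submatrix R C).submatrix id θ)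
    rw [Matrix.det_permute' θ (A.submatrix R C)] at h1
    rw [mul_assoc]
    exact h1
  simp_rw [hperm]
  rw [germAt_mul analyticAt_const (analyticAt_minor hF R C)]
  exact Ideal.mul_mem_left _ _ (Ideal.subset_span ⟨R, C, rfl⟩)

/-- The minor of `A` for the rows `R` and `i` and the columns `C` and `j`. -/
def borderedMinor (R : Fin r → Fin m) (C : Fin r → Fin n) (A : Mat m n) (i : Fin m) (j : Fin n) :
    ℂ :=
  ((Matrix.of A).submatrix (Sum.elim R fun _ : Unit => i) (Sum.elim C fun _ : Unit => j)).det

/-- A retraction of a neighbourhood in the space of matrices to the matrices of rank `r`. -/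
def rankRetract (R : Fin r → Fin m) (C : Fin r → Fin n) (A : Mat m n) : Mat m n :=
  fun i j => A i j - borderedMinor R C A i j * (((Matrix.of A).submatrix R C).det)⁻¹

/-- A bordered minor is the determinant of the block `B` at `R`, `C` times an entry of the Schur
complement. Subtracting that complement leaves a product that factors through dimension `r`. -/
lemma rankRetract_eq_mul {R : Fin r → Fin m} {C : Fin r → Fin n} {A : Mat m n}
    (h : ((Matrix.of A).submatrix R C).det ≠ 0) :
    Matrix.of (rankRetract R C A) = (Matrix.of A).submatrix id C *
      ((Matrix.of A).submatrix R C)⁻¹ * (Matrix.of A).submatrix R id := by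
  ext i j
  let B := (Matrix.of A).submatrix R C
  let _ : Invertible B := B.invertibleOfIsUnitDet h.isUnit
  have h1 : (Matrix.of A).submatrix (Sum.elim R fun _ : Unit => i) (Sum.elim C fun _ : Unit => j) =
      Matrix.fromBlocks B ((Matrix.of A).submatrix R fun _ : Unit => j)
        ((Matrix.of A).submatrix (fun _ : Unit => i) C)
        ((Matrix.of A).submatrix (fun _ : Unit => i) fun _ : Unit => j) := by
    ext (k | k) (l | l) <;> rfl
  have h2 : borderedMinor R C A i j =
      B.det * (A i j -
        ((Matrix.of A).submatrix id C * B⁻¹ * (Matrix.of A).submatrix R id) i j) := by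
    rw [borderedMinor, h1, Matrix.det_fromBlocks₁₁, Matrix.det_unique (n := Unit),
      Matrix.invOf_eq_nonsing_inv]
    rfl
  change A i j - borderedMinor R C A i j * B.det⁻¹ = _
  rw [h2, mul_comm B.det, mul_assoc, mul_inv_cancel₀ h, mul_one, sub_sub_cancel]

lemma rank_rankRetract {R : Fin r → Fin m} {C : Fin r → Fin n} {A : Mat m n}
    (h : ((Matrix.of A).submatrix R C).det ≠ 0) : (Matrix.of (rankRetract R C A)).rank = r := by
  apply le_antisymm
  · rw [rankRetract_eq_mul h]
    refine (Matrix.rank_mul_le_right _ _).trans ?_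
    simpa using Matrix.rank_le_height ((Matrix.of A).submatrix R id)
  · refine le_rank_of_minor_ne_zero (R := R) (C := C) ?_
    have : (Matrix.of (rankRetract R C A)).submatrix R C = (Matrix.of A).submatrix R C := by
      rw [rankRetract_eq_mul h]
      change (Matrix.of A).submatrix R C * ((Matrix.of A).submatrix R C)⁻¹ *
        (Matrix.of A).submatrix R C = _
      rw [Matrix.mul_nonsing_inv _ h.isUnit, Matrix.one_mul]
    rwa [this]

lemma borderedMinor_eq_zero {R : Fin r → Fin m} {C : Fin r → Fin n} {A : Mat m n}
    (hA : (Matrix.of A).rank ≤ r) (i : Fin m) (j : Fin n) : borderedMinor R C A i j = 0 := by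
  by_contra hne
  have h1 := Matrix.rank_of_isUnit _ ((Matrix.isUnit_iff_isUnit_det _).2 (Ne.isUnit hne))
  have h2 := Matrix.rank_submatrix_le (Matrix.of A) (Sum.elim R fun _ : Unit => i)
    (Sum.elim C fun _ : Unit => j)
  rw [h1, Fintype.card_sum, Fintype.card_fin, Fintype.card_unit] at h2
  omega

lemma analyticAt_borderedMinor {F : Cn N → Mat m n} {p : Cn N} (hF : AnalyticAt ℂ F p)
    (R : Fin r → Fin m) (C : Fin r → Fin n) (i : Fin m) (j : Fin n) :
    AnalyticAt ℂ (fun x => borderedMinor R C (F x) i j) p :=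
  analyticAt_det fun _ _ => analyticAt_entry hF _ _

/-- Near a matrix of rank `t - 1`, the functions that vanish on the matrices of rank `t - 1` belong
to the ideal of the `t`-minors. -/
theorem germAt_comp_mem_minorIdeal {F : Cn N → Mat m n} {p : Cn N} (hF : AnalyticAt ℂ F p)
    (hr : (Matrix.of (F p)).rank + 1 = t) {g : Mat m n → ℂ} (hg : AnalyticAt ℂ g (F p))
    (hg0 : ∀ᶠ A in 𝓝 (F p), (Matrix.of A).rank + 1 = t → g A = 0) :
    germAt (fun x => g (F x)) p ∈ minorIdeal t F p := by
  obtain ⟨R, C, hne⟩ := exists_minor_ne_zero (Matrix.of (F p)) le_rfl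
  have hden := (analyticAt_minor hF R C).fun_inv hne
  have hdiff (i j) : AnalyticAt ℂ (fun x => borderedMinor R C (F x) i j *
      (((Matrix.of (F x)).submatrix R C).det)⁻¹) p :=
    (analyticAt_borderedMinor hF R C i j).fun_mul hden
  have hretr : AnalyticAt ℂ (fun x => rankRetract R C (F x)) p :=
    analyticAt_pi_iff.2 fun i => analyticAt_pi_iff.2 fun j =>
      (analyticAt_entry hF i j).fun_sub (hdiff i j)
  have hp : rankRetract R C (F p) = F p := by
    funext i j
    rw [rankRetract, borderedMinor_eq_zero le_rfl, zero_mul, sub_zero]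
  -- The map `F` and its retraction agree at `p` and differ by multiples of bordered minors, whose
  -- size is `t` because the rank at `p` is `t - 1`. On the retraction `g` vanishes.
  have h1 := germAt_comp_sub_mem (J := minorIdeal t F p) hg hF hretr rfl hp (fun ℓ => by
    have hℓ : (fun x => ℓ (F x - rankRetract R C (F x))) = fun x => ∑ i, ∑ j,
        (borderedMinor R C (F x) i j * (((Matrix.of (F x)).submatrix R C).det)⁻¹) *
          ℓ (Pi.single i (Pi.single j 1)) := by
      funext x
      have hsum (M : Mat m n) : M = ∑ i, ∑ j, M i j • Pi.single i (Pi.single j (1 : ℂ)) := by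
        funext k l
        simp [Finset.sum_apply, Pi.single_apply, ite_apply]
      conv_lhs => rw [hsum (F x - rankRetract R C (F x))]
      simp [rankRetract]
    rw [hℓ, germAt_sum _ fun i => Finset.analyticAt_fun_sum _ fun j _ =>
      (hdiff i j).fun_mul analyticAt_const]
    refine Ideal.sum_mem _ fun i _ => ?_
    rw [germAt_sum _ fun j => (hdiff i j).fun_mul analyticAt_const]
    refine Ideal.sum_mem _ fun j _ => ?_
    rw [germAt_mul (hdiff i j) analyticAt_const,
      germAt_mul (analyticAt_borderedMinor hF R C i j) hden]
    refine Ideal.mul_mem_right _ _ (Ideal.mul_mem_right _ _ ?_)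
    exact germAt_minor_mem (Fintype.equivFinOfCardEq (by simp [hr])) hF _ _)
  have h2 : germAt (fun x => g (rankRetract R C (F x))) p = 0 := by
    rw [← germAt_zero]
    apply germAt_congr
    have ht : Tendsto (fun x => rankRetract R C (F x)) (𝓝 p) (𝓝 (F p)) := by
      have := hretr.continuousAt.tendsto
      rwa [hp] at this
    filter_upwards [ht.eventually hg0,
      (analyticAt_minor hF R C).continuousAt.eventually_ne hne] with x hx hx'
    exact hx (by rw [rank_rankRetract hx', hr])
  rwa [h2, sub_zero] at h1

end GenericRank

/-! ### Analytic solution of linear equations. -/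

section LinearSolve

variable {X Y : Type*} [NormedAddCommGroup X] [NormedSpace ℂ X] [NormedAddCommGroup Y]
  [NormedSpace ℂ Y]

/-- The solution `φ` of the equation `T φ + S = 0` for an invertible `T`. -/
def linSolve (T : Y →L[ℂ] Y) (S : X →L[ℂ] Y) : X →L[ℂ] Y := -(Ring.inverse T ∘L S)

lemma eq_linSolve_apply {T : Y →L[ℂ] Y} (hT : IsUnit T) {S : X →L[ℂ] Y} {x : X} {y : Y}
    (h : S x + T y = 0) : y = linSolve T S x := by
  have h2 := congrArg (fun y => (Ring.inverse T : Y →L[ℂ] Y) y) h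
  have h3 : (Ring.inverse T : Y →L[ℂ] Y) (T y) = y :=
    congrArg (fun R : Y →L[ℂ] Y => R y) (Ring.inverse_mul_cancel _ hT)
  simp only [map_add, map_zero, h3] at h2
  exact eq_neg_of_add_eq_zero_right h2

lemma analyticAt_linSolve [CompleteSpace Y] {V : Type*} [NormedAddCommGroup V] [NormedSpace ℂ V]
    {T : V → Y →L[ℂ] Y} {S : V → X →L[ℂ] Y} {p : V} (hT : AnalyticAt ℂ T p)
    (hS : AnalyticAt ℂ S p) (hu : IsUnit (T p)) :
    AnalyticAt ℂ (fun x => linSolve (T x) (S x)) p := by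
  obtain ⟨u, hu⟩ := hu
  have h1 : AnalyticAt ℂ (fun x => Ring.inverse (T x)) p :=
    AnalyticAt.fun_comp (g := Ring.inverse) (hu ▸ analyticAt_inverse u) hT
  have h2 : AnalyticAt ℂ (fun x => Ring.inverse (T x) ∘L S x) p :=
    AnalyticAt.fun_comp (g := fun q : (Y →L[ℂ] Y) × (X →L[ℂ] Y) => q.1 ∘L q.2)
      ((ContinuousLinearMap.compL ℂ X Y Y).analyticAt_bilinear _) (h1.prod hS)
  exact h2.fun_neg

end LinearSolve

/-! ### The kernel as a holomorphic map to a chart of the Grassmannian. -/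

section KernelChart

variable {m n : ℕ}

/-- The action of matrices on Euclidean space. -/
def matOp (m n : ℕ) :
    Mat m n →L[ℂ] (EuclideanSpace ℂ (Fin n) →L[ℂ] EuclideanSpace ℂ (Fin m)) :=
  LinearMap.toContinuousLinearMap
    { toFun := fun A => LinearMap.toContinuousLinearMap (Matrix.toLpLin 2 2 (Matrix.of A))
      map_add' := fun A B => by
        rw [← Matrix.of_add_of, map_add, map_add]
      map_smul' := fun c A => by
        rw [← Matrix.smul_of, map_smul, map_smul, RingHom.id_apply] }

lemma mem_matKer {A : Mat m n} {v : EuclideanSpace ℂ (Fin n)} :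
    v ∈ matKer A ↔ matOp m n A v = 0 := Iff.rfl

lemma finrank_matKer (A : Mat m n) :
    (Matrix.of A).rank + Module.finrank ℂ (matKer A) = n := by
  have h := LinearMap.finrank_range_add_finrank_ker (Matrix.toLpLin 2 2 (Matrix.of A))
  rw [finrank_euclideanSpace_fin] at h
  rw [Matrix.rank_eq_finrank_range_toLin (Matrix.of A) (PiLp.basisFun 2 ℂ (Fin m))
    (PiLp.basisFun 2 ℂ (Fin n)), ← Matrix.toLpLin_eq_toLin]
  exact h

variable {K : Submodule ℂ (EuclideanSpace ℂ (Fin n))}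

lemma mem_chartPoint {φ : GrChart K} (k : K) : (k + φ k : EuclideanSpace ℂ (Fin n)) ∈
    chartPoint K φ := ⟨k, rfl⟩

lemma chartPoint_zero : chartPoint K 0 = K := by
  rw [chartPoint]
  convert K.range_subtype using 2
  ext k
  simp

lemma finrank_chartPoint_le (φ : GrChart K) :
    Module.finrank ℂ (chartPoint K φ) ≤ Module.finrank ℂ K :=
  LinearMap.finrank_range_le _

/-- The composition `L ∘ A ∘ j` as a function of the matrix `A`. -/
def sandwich {m n : ℕ} {X E : Type*} [NormedAddCommGroup X] [NormedSpace ℂ X]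
    [NormedAddCommGroup E] [NormedSpace ℂ E] (j : X →L[ℂ] EuclideanSpace ℂ (Fin n))
    (L : EuclideanSpace ℂ (Fin m) →L[ℂ] E) : Mat m n →L[ℂ] (X →L[ℂ] E) :=
  (ContinuousLinearMap.compL ℂ X _ E L) ∘L ((ContinuousLinearMap.compL ℂ X _ _).flip j) ∘L matOp m n

lemma sandwich_apply {X E : Type*} [NormedAddCommGroup X] [NormedSpace ℂ X]
    [NormedAddCommGroup E] [NormedSpace ℂ E] {j : X →L[ℂ] EuclideanSpace ℂ (Fin n)}
    {L : EuclideanSpace ℂ (Fin m) →L[ℂ] E} (A : Mat m n) (v : X) :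
    sandwich j L A v = L (matOp m n A (j v)) := rfl

lemma analyticAt_linSolve_sandwich {X Y : Type*} [NormedAddCommGroup X] [NormedSpace ℂ X]
    [NormedAddCommGroup Y] [NormedSpace ℂ Y] [CompleteSpace Y]
    {i : Y →L[ℂ] EuclideanSpace ℂ (Fin n)} {j : X →L[ℂ] EuclideanSpace ℂ (Fin n)}
    {L : EuclideanSpace ℂ (Fin m) →L[ℂ] Y} {A : Mat m n} (hA : IsUnit (sandwich i L A)) :
    AnalyticAt ℂ (fun A => linSolve (sandwich i L A) (sandwich j L A)) A :=
  analyticAt_linSolve ((sandwich i L).analyticAt A) ((sandwich j L).analyticAt A) hA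

lemma isOpen_isUnit_sandwich {Y : Type*} [NormedAddCommGroup Y] [NormedSpace ℂ Y]
    [CompleteSpace Y] {i : Y →L[ℂ] EuclideanSpace ℂ (Fin n)}
    {L : EuclideanSpace ℂ (Fin m) →L[ℂ] Y} : IsOpen {A : Mat m n | IsUnit (sandwich i L A)} :=
  Units.isOpen.preimage (sandwich i L).continuous

/-- A matrix has a left inverse on the orthogonal complement of its kernel. -/
lemma exists_sandwich_eq_one (A : Mat m n) :
    ∃ L : EuclideanSpace ℂ (Fin m) →L[ℂ] (matKer A)ᗮ, sandwich (matKer A)ᗮ.subtypeL L A = 1 := by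
  let T : (matKer A)ᗮ →ₗ[ℂ] EuclideanSpace ℂ (Fin m) :=
    (matOp m n A ∘L (matKer A)ᗮ.subtypeL : (matKer A)ᗮ →L[ℂ] EuclideanSpace ℂ (Fin m))
  have hT : LinearMap.ker T = ⊥ := by
    rw [LinearMap.ker_eq_bot']
    intro v hv
    have h1 : (v : EuclideanSpace ℂ (Fin n)) ∈ matKer A := mem_matKer.2 hv
    have h2 := (Submodule.mem_orthogonal _ _).1 v.2 _ h1
    exact Subtype.ext (inner_self_eq_zero.1 h2)
  obtain ⟨L, hL⟩ := LinearMap.exists_leftInverse_of_injective T hT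
  refine ⟨LinearMap.toContinuousLinearMap L, ?_⟩
  ext1 v
  exact LinearMap.congr_fun hL v

variable (L : EuclideanSpace ℂ (Fin m) →L[ℂ] Kᗮ)

/-- The coordinate in the chart around `K` of the kernel of a matrix. -/
def kerCoord (A : Mat m n) : GrChart K :=
  linSolve (sandwich Kᗮ.subtypeL L A) (sandwich K.subtypeL L A)

/-- After applying `L`, the equation `A (k + w) = 0` is a linear equation for `w` with invertible
coefficient. -/
lemma eq_kerCoord_apply {A : Mat m n} (hA : IsUnit (sandwich Kᗮ.subtypeL L A)) {k : K} {w : Kᗮ}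
    (h : matOp m n A (k + w) = 0) : w = kerCoord L A k := by
  refine eq_linSolve_apply hA ?_
  rw [sandwich_apply, sandwich_apply, ← map_add, ← map_add]
  exact (congrArg L h).trans (map_zero L)

lemma eq_kerCoord {A : Mat m n} (hA : IsUnit (sandwich Kᗮ.subtypeL L A)) {φ : GrChart K}
    (h : matKer A = chartPoint K φ) : φ = kerCoord L A := by
  ext1 k
  refine eq_kerCoord_apply L hA (mem_matKer.1 ?_)
  rw [h]
  exact mem_chartPoint k

/-- Since `L` may lose equations, solving them only places the kernel inside the graph; the rank
hypothesis gives equality by dimension. -/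
lemma matKer_eq_chartPoint {A : Mat m n} (hA : IsUnit (sandwich Kᗮ.subtypeL L A))
    (hr : (Matrix.of A).rank + Module.finrank ℂ K = n) :
    matKer A = chartPoint K (kerCoord L A) := by
  refine Submodule.eq_of_le_of_finrank_le ?_ ?_
  · intro v hv
    obtain ⟨k, hk, w, hw, rfl⟩ := K.exists_add_mem_mem_orthogonal v
    refine ⟨⟨k, hk⟩, ?_⟩
    have := eq_kerCoord_apply L hA (k := ⟨k, hk⟩) (w := ⟨w, hw⟩) (mem_matKer.1 hv)
    simp [← this]
  · have h1 := finrank_matKer A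
    have h2 := finrank_chartPoint_le (kerCoord L A)
    omega

variable {L}

lemma analyticAt_kerCoord {A : Mat m n} (hA : IsUnit (sandwich Kᗮ.subtypeL L A)) :
    AnalyticAt ℂ (kerCoord L) A :=
  analyticAt_linSolve_sandwich hA

end KernelChart

/-! ### The Tjurina transform over points of rank `t - 1`. -/

section TjurinaTransform

variable {N m n t : ℕ} {F : Cn N → Mat m n} {p : Cn N}

/-- That `A` kills the subspace is a closed condition, so it survives the passage to the closure of
the graph. -/
lemma matOp_eq_zero_of_mem_tjurinaW {K : Submodule ℂ (EuclideanSpace ℂ (Fin n))}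
    {w : Mat m n × GrChart K} (hw : w ∈ tjurinaW m t K) (k : K) :
    matOp m n w.1 (k + w.2 k) = 0 := by
  have hcl : IsClosed {w : Mat m n × GrChart K | matOp m n w.1 (k + w.2 k) = 0} := by
    refine isClosed_eq ?_ continuous_const
    fun_prop
  refine closure_minimal ?_ hcl hw
  rintro ⟨A, φ⟩ ⟨-, h⟩
  refine mem_matKer.1 ?_
  rw [h]
  exact mem_chartPoint k

/-- Over a point with `rk F(p) = t - 1`, the kernel of `F(p)` is the only point of the Tjurina
transform. -/
theorem isTjurinaPoint_iff (hr : (Matrix.of (F p)).rank + 1 = t)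
    {K : Submodule ℂ (EuclideanSpace ℂ (Fin n))} :
    IsTjurinaPoint t F p K ↔ K = matKer (F p) := by
  have hfin := finrank_matKer (F p)
  constructor
  · rintro ⟨hK, -, hW⟩
    refine Submodule.eq_of_le_of_finrank_eq (fun k hk => ?_) (by omega)
    have := matOp_eq_zero_of_mem_tjurinaW hW ⟨k, hk⟩
    simpa [mem_matKer] using this
  · rintro rfl
    refine ⟨by omega, show (Matrix.of (F p)).rank < t by omega, subset_closure ⟨hr, ?_⟩⟩
    exact chartPoint_zero.symm

/-- Over a point with `rk F(p) = t - 1`, the local rings of `X` and of its Tjurina transform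
are isomorphic. -/
theorem nonempty_ringEquiv_tjurina (hF : AnalyticAt ℂ F p)
    (hr : (Matrix.of (F p)).rank + 1 = t) :
    Nonempty (detLocalRing t F p ≃+*
      HolGerm ((p, 0) : Cn N × GrChart (matKer (F p))) ⧸ tjurinaIdeal t F p (matKer (F p))) := by
  set K := matKer (F p) with hK
  obtain ⟨L, hL⟩ : ∃ L : EuclideanSpace ℂ (Fin m) →L[ℂ] Kᗮ, sandwich Kᗮ.subtypeL L (F p) = 1 :=
    exists_sandwich_eq_one (F p)
  let P : Mat m n → GrChart K := kerCoord L
  have hunit : IsUnit (sandwich Kᗮ.subtypeL L (F p)) := hL ▸ isUnit_one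
  have hfin : (Matrix.of (F p)).rank + Module.finrank ℂ K = n := finrank_matKer (F p)
  have hPan : AnalyticAt ℂ P (F p) := analyticAt_kerCoord hunit
  have hP0 : P (F p) = 0 := (eq_kerCoord L hunit (φ := 0) (by rw [chartPoint_zero, hK])).symm
  have hnear : ∀ᶠ A in 𝓝 (F p), IsUnit (sandwich Kᗮ.subtypeL L A) :=
    isOpen_isUnit_sandwich.mem_nhds hunit
  have hfst : AnalyticAt ℂ (Prod.fst : Cn N × GrChart K → Cn N) (p, 0) := analyticAt_fst
  have hPF : AnalyticAt ℂ (fun x => P (F x)) p := hPan.fun_comp hF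
  have hι : AnalyticAt ℂ (fun x => (x, P (F x))) p := analyticAt_id.prod hPF
  have hιp : (p, P (F p)) = ((p, 0) : Cn N × GrChart K) := by rw [hP0]
  have hF1 : AnalyticAt ℂ (fun y : Cn N × GrChart K => F y.1) (p, 0) := hF.fun_comp hfst
  have hF12 : AnalyticAt ℂ (fun y : Cn N × GrChart K => (F y.1, y.2)) (p, 0) :=
    hF1.prod analyticAt_snd
  -- `Φ` restricts to the graph of `P ∘ F`, and `Ψ` pulls back along the projection; they become
  -- inverse to each other modulo the ideals.
  let Φ := germPullback (q := ((p, 0) : Cn N × GrChart K)) (fun x => (x, P (F x))) hι hιp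
  let Ψ := germPullback (q := p) Prod.fst hfst rfl
  let I := minorIdeal t F p
  let J := tjurinaIdeal t F p K
  have hΦ : J ≤ I.comap Φ := by
    refine Ideal.span_le.2 ?_
    rintro _ (⟨R, C, rfl⟩ | ⟨f, hf, hf0, rfl⟩)
    · change Φ _ ∈ I
      rw [germPullback_germAt hι hιp (analyticAt_minor hF1 R C)]
      exact Ideal.subset_span ⟨R, C, rfl⟩
    · change Φ _ ∈ I
      have hfF : AnalyticAt ℂ (fun y : Cn N × GrChart K => f (F y.1, y.2)) (p, 0) :=
        AnalyticAt.fun_comp (g := f) hf hF12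
      rw [germPullback_germAt hι hιp hfF]
      have hgr : AnalyticAt ℂ (fun A => (A, P A)) (F p) := analyticAt_id.prod hPan
      have hgr0 : (F p, P (F p)) = (F p, 0) := by rw [hP0]
      have htend : Tendsto (fun A => (A, P A)) (𝓝 (F p)) (𝓝 (F p, 0)) := by
        simpa only [hgr0] using hgr.continuousAt.tendsto
      refine germAt_comp_mem_minorIdeal (g := fun A => f (A, P A)) hF hr
        (AnalyticAt.fun_comp (g := f) (by rwa [hP0]) hgr) ?_
      filter_upwards [htend.eventually hf0, hnear] with A hA hu hrA
      have hrA' : (Matrix.of A).rank + Module.finrank ℂ K = n := by omega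
      exact hA (subset_closure ⟨hrA, matKer_eq_chartPoint L hu hrA'⟩)
  have hΨ : I ≤ J.comap Ψ := by
    refine Ideal.span_le.2 ?_
    rintro _ ⟨R, C, rfl⟩
    change Ψ _ ∈ J
    rw [germPullback_germAt hfst rfl (analyticAt_minor hF R C)]
    exact Ideal.subset_span (Or.inl ⟨R, C, rfl⟩)
  -- The components of `φ - P(A)` are equations of `W` near the base point: they vanish where `φ` is
  -- the coordinate of the kernel, and on the closure by continuity. Hence the coordinates of `y -
  -- (y.1, P (F y.1))` lie in `J`.
  have hcoord (ℓ : Cn N × GrChart K →L[ℂ] ℂ) :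
      germAt (fun y : Cn N × GrChart K => ℓ (y - (y.1, P (F y.1)))) (p, 0) ∈ J := by
    let f : Mat m n × GrChart K → ℂ := fun w => ℓ (0, w.2 - P w.1)
    have hP1 : AnalyticAt ℂ (fun w : Mat m n × GrChart K => P w.1) (F p, 0) :=
      AnalyticAt.fun_comp (g := P) hPan analyticAt_fst
    have hf : AnalyticAt ℂ f (F p, 0) :=
      (ℓ.analyticAt _).fun_comp (analyticAt_const.prod (analyticAt_snd.fun_sub hP1))
    refine Ideal.subset_span (Or.inr ⟨f, hf, ?_, ?_⟩)
    · have hnear' : ∀ᶠ w : Mat m n × GrChart K in 𝓝 (F p, 0), IsUnit (sandwich Kᗮ.subtypeL L w.1) :=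
        (continuous_fst.tendsto (F p, 0)).eventually hnear
      filter_upwards [hf.eventually_analyticAt, hnear'.eventually_nhds] with w hw hu hwW
      have hne : (𝓝[{w | (Matrix.of w.1).rank + 1 = t ∧ matKer w.1 = chartPoint K w.2}] w).NeBot :=
        mem_closure_iff_nhdsWithin_neBot.1 hwW
      have hlim := hw.continuousAt.tendsto.mono_left
        (nhdsWithin_le_nhds (s := {w | (Matrix.of w.1).rank + 1 = t ∧
          matKer w.1 = chartPoint K w.2}))
      refine tendsto_nhds_unique hlim (tendsto_const_nhds.congr' ?_)
      filter_upwards [self_mem_nhdsWithin, nhdsWithin_le_nhds hu] with z hz huz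
      have := eq_kerCoord L huz hz.2
      simp only [f, P, ← this, sub_self]
      exact (map_zero ℓ).symm
    · congr 1
      funext y
      simp only [f]
      congr 1
      ext <;> simp
  have hΨΦ (a : HolGerm ((p, 0) : Cn N × GrChart K)) : a - Ψ (Φ a) ∈ J := by
    obtain ⟨f, hf, rfl⟩ := exists_germAt_eq a
    have hfι : AnalyticAt ℂ (fun x => f (x, P (F x))) p :=
      AnalyticAt.fun_comp (by rwa [hιp]) hι
    rw [germPullback_germAt hι hιp hf, germPullback_germAt hfst rfl hfι]
    exact germAt_comp_sub_mem (J := J) hf (a := fun y => y) (b := fun y => (y.1, P (F y.1)))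
      analyticAt_id (hι.fun_comp hfst) rfl hιp hcoord
  have hΦΨ (a : HolGerm p) : Φ (Ψ a) = a := by
    obtain ⟨f, hf, rfl⟩ := exists_germAt_eq a
    have hf1 : AnalyticAt ℂ (fun y : Cn N × GrChart K => f y.1) (p, 0) := hf.fun_comp hfst
    rw [germPullback_germAt hfst rfl hf, germPullback_germAt hι hιp hf1]
  refine ⟨RingEquiv.ofRingHom (Ideal.quotientMap J Ψ hΨ) (Ideal.quotientMap I Φ hΦ) ?_ ?_⟩
  · refine Ideal.Quotient.ringHom_ext (RingHom.ext fun a => ?_)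
    simp only [RingHom.comp_apply, Ideal.quotientMap_mk, RingHom.id_apply]
    exact (Ideal.Quotient.eq.2 (hΨΦ a)).symm
  · refine Ideal.Quotient.ringHom_ext (RingHom.ext fun a => ?_)
    change Ideal.quotientMap I Φ hΦ (Ideal.quotientMap J Ψ hΨ (Ideal.Quotient.mk I a)) =
      Ideal.Quotient.mk I a
    rw [Ideal.quotientMap_mk, Ideal.quotientMap_mk, hΦΨ]

/-- At a point with `rk F(p) = t - 1`, the space `X` is singular if and only if its Tjurina
transform is singular. -/
theorem isSingularAt_iff_isTjurinaSingularAt (hF : AnalyticAt ℂ F p)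
    (hr : (Matrix.of (F p)).rank + 1 = t) {K : Submodule ℂ (EuclideanSpace ℂ (Fin n))}
    (hK : IsTjurinaPoint t F p K) : IsSingularAt t F p ↔ IsTjurinaSingularAt t F p K := by
  obtain rfl := (isTjurinaPoint_iff hr).1 hK
  obtain ⟨e⟩ := nonempty_ringEquiv_tjurina hF hr
  constructor
  · rintro ⟨-, h⟩
    exact ⟨hK, fun hreg => h (IsRegularLocalRing.of_ringEquiv e.symm)⟩
  · rintro ⟨-, h⟩
    exact ⟨hK.2.1, fun hreg => h (IsRegularLocalRing.of_ringEquiv e)⟩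

end TjurinaTransform

end DetSing

end

/-! ### The decomposition of the discriminant. -/

theorem mainTheorem3 {N m n t τ : ℕ}
    (F : DetSing.Cn N → DetSing.Mat m n) (G : Fin τ → DetSing.Cn N → DetSing.Mat m n)
    (hX : DetSing.IsDeterminantal t F)
    (hdim : (m : WithBot ℕ∞) ≤ ringKrullDim (DetSing.detLocalRing t F 0))
    (hG : DetSing.IsGVersalBasis F G) :
    ∃ U₀ ∈ 𝓝 (0 : DetSing.Cn N), ∃ S₀ ∈ 𝓝 (0 : DetSing.Cn τ),
      -- the discriminant is the union of the two contributions, for every smaller representative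
      (∀ U ⊆ U₀, ∀ S ⊆ S₀,
        DetSing.discriminant t (DetSing.versalFamily F G) U S =
            DetSing.contributionA t (DetSing.versalFamily F G) U S ∪
              DetSing.contributionB t (DetSing.versalFamily F G) U S ∧
        DetSing.discriminant t (DetSing.versalFamily F G) U S =
            DetSing.contributionA t (DetSing.versalFamily F G) U S ∪
              DetSing.contributionB' t (DetSing.versalFamily F G) U S) ∧
      -- the decomposition comes from one of the singular points of the fibres
      (∀ s ∈ S₀, ∀ x ∈ U₀,
        (DetSing.versalFamily F G s x ∈ DetSing.genericDet m n (t - 1) →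
          DetSing.IsSingularAt t (DetSing.versalFamily F G s) x) ∧
        ((Matrix.of (DetSing.versalFamily F G s x)).rank + 1 = t →
          (∃! K, DetSing.IsTjurinaPoint t (DetSing.versalFamily F G s) x K) ∧
          ∀ K, DetSing.IsTjurinaPoint t (DetSing.versalFamily F G s) x K →
            (DetSing.IsSingularAt t (DetSing.versalFamily F G s) x ↔
              DetSing.IsTjurinaSingularAt t (DetSing.versalFamily F G s) x K))) := by
  obtain ⟨U₀, hU₀, S₀, hS₀, R, C, hRC⟩ := DetSing.exists_nhds_versalFamily hX hG.analytic
  have hlow : ∀ s ∈ S₀, ∀ x ∈ U₀,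
      DetSing.versalFamily F G s x ∈ DetSing.genericDet m n (t - 1) →
        DetSing.IsSingularAt t (DetSing.versalFamily F G s) x := fun s hs x hx h =>
    DetSing.isSingularAt_of_rank_lt (hRC s hs x hx).1 h (hRC s hs x hx).2
  have hmid : ∀ s ∈ S₀, ∀ x ∈ U₀, (Matrix.of (DetSing.versalFamily F G s x)).rank + 1 = t →
      (∃! K, DetSing.IsTjurinaPoint t (DetSing.versalFamily F G s) x K) ∧
      ∀ K, DetSing.IsTjurinaPoint t (DetSing.versalFamily F G s) x K →
        (DetSing.IsSingularAt t (DetSing.versalFamily F G s) x ↔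
          DetSing.IsTjurinaSingularAt t (DetSing.versalFamily F G s) x K) := fun s hs x hx h =>
    ⟨⟨_, (DetSing.isTjurinaPoint_iff h).2 rfl, fun _ => (DetSing.isTjurinaPoint_iff h).1⟩,
      fun K hK => DetSing.isSingularAt_iff_isTjurinaSingularAt (hRC s hs x hx).1 h hK⟩
  refine ⟨U₀, hU₀, S₀, hS₀, fun U hU S hS => ?_, fun s hs x hx =>
    ⟨hlow s hs x hx, hmid s hs x hx⟩⟩
  have hA : DetSing.contributionA t (DetSing.versalFamily F G) U S ⊆
      DetSing.discriminant t (DetSing.versalFamily F G) U S := by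
    rintro s ⟨hs, x, hx, hminors⟩
    exact ⟨hs, x, hx, hlow s (hS hs) x (hU hx) (DetSing.rank_lt_iff_minors_eq_zero.2 hminors)⟩
  have hB : DetSing.contributionB t (DetSing.versalFamily F G) U S ⊆
      DetSing.discriminant t (DetSing.versalFamily F G) U S := by
    rintro s ⟨hs, x, hx, hsing, -⟩
    exact ⟨hs, x, hx, hsing⟩
  have hB' : DetSing.contributionB' t (DetSing.versalFamily F G) U S ⊆
      DetSing.contributionB t (DetSing.versalFamily F G) U S := by
    rintro s ⟨hs, x, hx, -, h⟩
    exact ⟨hs, x, hx, h⟩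
  -- The inclusions `D ⊆ A ∪ B' ⊆ A ∪ B ⊆ D` give both decompositions at once.
  have hD : DetSing.discriminant t (DetSing.versalFamily F G) U S ⊆
      DetSing.contributionA t (DetSing.versalFamily F G) U S ∪
        DetSing.contributionB' t (DetSing.versalFamily F G) U S := by
    rintro s ⟨hs, x, hx, hsing⟩
    have hlt : (Matrix.of (DetSing.versalFamily F G s x)).rank < t := hsing.1
    by_cases h : (Matrix.of (DetSing.versalFamily F G s x)).rank < t - 1
    · exact Or.inl ⟨hs, x, hx, DetSing.rank_lt_iff_minors_eq_zero.1 h⟩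
    -- `hlt` makes `t` positive, so truncation in `t - 1` is harmless.
    · have hr : (Matrix.of (DetSing.versalFamily F G s x)).rank + 1 = t := by omega
      obtain ⟨⟨K, hK, -⟩, hiff⟩ := hmid s (hS hs) x (hU hx) hr
      exact Or.inr ⟨hs, x, hx, hr, hsing, K, (hiff K hK).1 hsing⟩
  exact ⟨(hD.trans (Set.union_subset_union_right _ hB')).antisymm (Set.union_subset hA hB),
    hD.antisymm (Set.union_subset hA (hB'.trans hB))⟩
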